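/- Setting. For each $k\in\mathbb{N}$ let $n=n_k$, $p=p_k$, $r=r_k$, with $n,p,r\to\infty$ as $k\to\infty$ (the index $k$ is suppressed below). The random vectors $\mathbf{X}\in\mathbb{R}^p$ and $\mathbf{Y}\in\mathbb{R}^r$ follow the linear model $\mathbf{Y}=\boldsymbol\alpha+\boldsymbol\beta\mathbf{X}+\boldsymbol\varepsilon$ with $\boldsymbol\varepsilon$ independent of $\mathbf{X}$, and are jointly sub-Gaussian with a constant $\sigma>0$ that does not depend on $k$: $P(|\mathbf{w}^{\top}(\mathbf{X}^\top,\mathbf{Y}^\top)^\top|\ge t)\le 2\exp(-t^2/\sigma^2)$ for all $t\ge0$ and all $\mathbf{w}\in\mathbb{R}^{p+r}$ with $\|\mathbf{w}\|_2=1$. The data are $n$ i.i.d. copies of $(\mathbf{X},\mathbf{Y})$. Let $\Sigma_{\mathbf{X}},\Sigma_{\mathbf{Y}},\Sigma_{\mathbf{XY}}=\Sigma_{\mathbf{YX}}^\top$ be the covariance and cross-covariance matrices, and let hats denote the corresponding (centred, normalised by $1/n$) sample covariance matrices. Write $\|A\|_1=\max_j\sum_i|a_{ij}|$ and let $\lambda_1(\mathbf{M})\ge\lambda_2(\mathbf{M})\ge\cdots$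 be the eigenvalues of a symmetric matrix $\mathbf{M}$. For a symmetric $m\times m$ matrix $\mathbf{M}$ and a positive semi-definite $m\times m$ matrix $\mathbf{U}$, the envelope $\mathcal{E}=\mathcal{E}_{\mathbf{M}}(\mathbf{U})$ is the intersection of all subspaces $\mathcal R\subseteq\mathbb{R}^m$ that contain $\mathrm{span}(\mathbf{U})$ and satisfy $\mathbf{M}=\mathbf{P}_{\mathcal R}\mathbf{M}\mathbf{P}_{\mathcal R}+(\mathbf{I}-\mathbf{P}_{\mathcal R})\mathbf{M}(\mathbf{I}-\mathbf{P}_{\mathcal R})$, where $\mathbf{P}_{\mathcal R}$ is the orthogonal projection onto $\mathcal R$. Let $u\ge1$ be its dimension, which is known. The NIECE procedure with input $(\mathbf{M},\mathbf{U},d,u)$ takes orthonormal eigenvectors $\mathbf{v}_1,\dots,\mathbf{v}_d$ of $\mathbf{M}$ for its $d$ largest eigenvalues, orders their scores $\phi_j=\mathbf{v}_j^\top\mathbf{U}\mathbf{v}_j$ decreasingly, $\phi_{(1)}\ge\dots\ge\phi_{(d)}$, and returns the span of the eigenvectors $\mathbf{v}_{(1)},\dots,\mathbf{v}_{(u)}$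 with the $u$ largest scores (ties being broken arbitrarily). The estimator $\widehat{\mathcal{E}}$ is its output for the input $(\widehat{\mathbf{M}},\widehat{\mathbf{U}},d,u)$. The response envelope is the case $\mathbf{M}=\Sigma_{\mathbf{Y}}$, $\mathbf{U}=\Sigma_{\mathbf{YX}}\Sigma_{\mathbf{XY}}$, $\widehat{\mathbf{M}}=\widehat\Sigma_{\mathbf{Y}}$, $\widehat{\mathbf{U}}=\widehat\Sigma_{\mathbf{YX}}\widehat\Sigma_{\mathbf{XY}}$; the predictor envelope is the case $\mathbf{M}=\Sigma_{\mathbf{X}}$, $\mathbf{U}=\Sigma_{\mathbf{XY}}\Sigma_{\mathbf{YX}}$, $\widehat{\mathbf{M}}=\widehat\Sigma_{\mathbf{X}}$, $\widehat{\mathbf{U}}=\widehat\Sigma_{\mathbf{XY}}\widehat\Sigma_{\mathbf{YX}}$. In either case assume, with $d$ fixed, that $\mathcal{E}\subseteq\mathrm{span}(\mathbf{v}_1,\dots,\mathbf{v}_d)$ and that the minimal eigen-gap $\Delta=\min_{1\le j\le d}\{\lambda_j(\mathbf{M})-\lambda_{j+1}(\mathbf{M})\}$ (with $\lambda_{m+1}=-\infty$)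 is bounded below by a positive constant that does not depend on $k$. Let $\Delta_{\mathbf{U}}=\phi_{(u)}-\phi_{(u+1)}$ be the gap of the population scores (with $\phi_{(d+1)}=0$). Corollary. Suppose that $\|\Sigma_{\mathbf{XY}}\|_1+\|\Sigma_{\mathbf{YX}}\|_1<c_1$ for a constant $c_1$ that does not depend on $k$. For each of the two envelopes (response and predictor), if its own $d$, $\Delta$, $u$ and $\Delta_{\mathbf{U}}$ satisfy the assumptions above and $$\max\left(pr\sqrt{\log p+\log r},\ pr\,\Delta_{\mathbf{U}}^{-1}\sqrt{\log p+\log r}\right)=o(\sqrt n),$$ then $\|\mathbf{P}_{\widehat{\mathcal{E}}}-\mathbf{P}_{\mathcal{E}}\|_F\to0$ in probability as $n,p,r\to\infty$. -/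

import Mathlib

open MeasureTheory ProbabilityTheory Filter Topology Asymptotics Matrix

namespace NIECE

noncomputable section

/-! ### Matrices, norms and eigenvalues -/

/-- The norm `‖A‖₁ = max_j ∑_i |a_ij|`. -/
def l1Norm {a b : ℕ} (A : Matrix (Fin a) (Fin b) ℝ) : ℝ :=
  ⨆ j, ∑ i, |A i j|

/-- The Frobenius norm `‖A‖_F`. -/
def frobNorm {a b : ℕ} (A : Matrix (Fin a) (Fin b) ℝ) : ℝ :=
  Real.sqrt (∑ i, ∑ j, A i j ^ 2)

/-- The column space of a matrix. -/
def colSpan {m q : ℕ} (B : Matrix (Fin m) (Fin q) ℝ) :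
    Submodule ℝ (EuclideanSpace ℝ (Fin m)) :=
  Submodule.span ℝ (Set.range fun j : Fin q => WithLp.toLp 2 fun i : Fin m => B i j)

/-- The matrix `P_S` of the orthogonal projection onto a subspace `S` of `ℝ^m`. -/
def projMatrix {m : ℕ} (S : Submodule ℝ (EuclideanSpace ℝ (Fin m))) :
    Matrix (Fin m) (Fin m) ℝ :=
  Matrix.of fun i j => (S.starProjection (EuclideanSpace.single j (1 : ℝ))) i

/-- The `(j+1)`-st largest eigenvalue (counted with multiplicity) of a symmetric `m × m` matrix,
for `j < m`; the value in all other cases is not used. -/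
def sortedEigenvalue {m : ℕ} (M : Matrix (Fin m) (Fin m) ℝ) (j : ℕ) : ℝ :=
  open Classical in
  if h : M.IsHermitian ∧ j < m then
    h.1.eigenvalues₀ ⟨j, by simpa using h.2⟩
  else 0

/-- `Δ`, the minimum over `j = 1, …, d` of `λ_j(M) - λ_{j+1}(M)`, for an `m × m` matrix, where
`λ_{m+1} = -∞`. -/
def minEigenGap {m : ℕ} (M : Matrix (Fin m) (Fin m) ℝ) (d : ℕ) : EReal :=
  ⨅ j : Fin d,
    if (j : ℕ) + 1 < m then
      ((sortedEigenvalue M j - sortedEigenvalue M (j + 1) : ℝ) : EReal)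
    else ⊤

/-! ### Envelopes -/

/-- `R` is a reducing subspace of `M`: `M = P_R M P_R + Q_R M Q_R`. -/
def IsReducing {m : ℕ} (M : Matrix (Fin m) (Fin m) ℝ)
    (R : Submodule ℝ (EuclideanSpace ℝ (Fin m))) : Prop :=
  M = projMatrix R * M * projMatrix R + (1 - projMatrix R) * M * (1 - projMatrix R)

/-- The `M`-envelope of `span(B)`: the intersection of all reducing subspaces of `M` that contain
`span(B)`. -/
def envelope {m q : ℕ} (M : Matrix (Fin m) (Fin m) ℝ) (B : Matrix (Fin m) (Fin q) ℝ) :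
    Submodule ℝ (EuclideanSpace ℝ (Fin m)) :=
  sInf {R | IsReducing M R ∧ colSpan B ≤ R}

/-! ### The NIECE procedure -/

/-- `v` is an orthonormal system of first `d` eigenvectors of `M`: `v j` belongs to the `(j+1)`-st
largest eigenvalue. -/
def IsTopEigenvectors {m d : ℕ} (M : Matrix (Fin m) (Fin m) ℝ)
    (v : Fin d → EuclideanSpace ℝ (Fin m)) : Prop :=
  Orthonormal ℝ v ∧
    ∀ j, Matrix.toEuclideanLin M (v j) = sortedEigenvalue M j • v j

/-- The envelope scores `φ_j = v_jᵀ U v_j`. -/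
def score {m d : ℕ} (U : Matrix (Fin m) (Fin m) ℝ) (v : Fin d → EuclideanSpace ℝ (Fin m))
    (j : Fin d) : ℝ :=
  inner ℝ (v j) (Matrix.toEuclideanLin U (v j))

/-- The `j`-th largest score `φ_(j)` for `j = 1, …, d`, and `0` for any other `j`. -/
def orderedScore {m d : ℕ} (U : Matrix (Fin m) (Fin m) ℝ) (v : Fin d → EuclideanSpace ℝ (Fin m))
    (j : ℕ) : ℝ :=
  if h : 1 ≤ j ∧ j ≤ d then
    score U v (Tuple.sort (fun i => -score U v i) ⟨j - 1, by omega⟩)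
  else 0

/-- The envelope score gap `Δ_U = φ_(u) - φ_(u+1)`. -/
def scoreGap {m d : ℕ} (U : Matrix (Fin m) (Fin m) ℝ) (v : Fin d → EuclideanSpace ℝ (Fin m))
    (u : ℕ) : ℝ :=
  orderedScore U v u - orderedScore U v (u + 1)

/-- `S` is an output of the NIECE procedure for the input `M`, `U`, `d`, `u`: the span of those `u`
of the first `d` eigenvectors of `M` whose scores are the largest. Every choice of eigenvectors and
every way to break ties between scores is an admissible run. -/
def IsNIECEOutput {m : ℕ} (M U : Matrix (Fin m) (Fin m) ℝ) (d u : ℕ)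
    (S : Submodule ℝ (EuclideanSpace ℝ (Fin m))) : Prop :=
  ∃ (v : Fin d → EuclideanSpace ℝ (Fin m)) (π : Equiv.Perm (Fin d)),
    IsTopEigenvectors M v ∧
    Antitone (fun j => score U v (π j)) ∧
    S = Submodule.span ℝ ((fun j => v (π j)) '' {j : Fin d | (j : ℕ) < u})

/-! ### Covariances and tails -/

/-- The population (cross-)covariance matrix of two random vectors. -/
def crossCov {Ω : Type*} [MeasurableSpace Ω] {a b : ℕ} (μ : Measure Ω)
    (X : Ω → Fin a → ℝ) (Y : Ω → Fin b → ℝ) : Matrix (Fin a) (Fin b) ℝ :=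
  Matrix.of fun i j => covariance (fun ω => X ω i) (fun ω => Y ω j) μ

/-- The sample mean of `x_1, …, x_n`. -/
def sampleMean {n a : ℕ} (x : Fin n → Fin a → ℝ) (i : Fin a) : ℝ :=
  (n : ℝ)⁻¹ * ∑ s, x s i

/-- The sample (cross-)covariance matrix `n⁻¹ ∑_s (x_s - x̄)(y_s - ȳ)ᵀ`. -/
def sampleCrossCov {n a b : ℕ} (x : Fin n → Fin a → ℝ) (y : Fin n → Fin b → ℝ) :
    Matrix (Fin a) (Fin b) ℝ :=
  Matrix.of fun i j => (n : ℝ)⁻¹ * ∑ s, (x s i - sampleMean x i) * (y s j - sampleMean y j)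

/-- Joint sub-Gaussian tails: `P(|wᵀ(Xᵀ,Yᵀ)ᵀ| ≥ t) ≤ 2 exp(-t²/σ²)` for all unit vectors `w`
and all `t ≥ 0`. -/
def JointSubGaussian {Ω : Type*} [MeasurableSpace Ω] {a b : ℕ} (μ : Measure Ω)
    (X : Ω → Fin a → ℝ) (Y : Ω → Fin b → ℝ) (σ : ℝ) : Prop :=
  ∀ w : EuclideanSpace ℝ (Fin a ⊕ Fin b), ‖w‖ = 1 → ∀ t : ℝ, 0 ≤ t →
    μ.real {ω | t ≤ |∑ i, w i * Sum.elim (X ω) (Y ω) i|} ≤ 2 * Real.exp (-(t ^ 2 / σ ^ 2))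

/-- Convergence to `0` in probability of nonnegative random quantities along a sequence of
probability spaces. For a set that is not measurable, `μ k` is the outer measure. -/
def TendstoZeroInProbability {Ω : ℕ → Type*} [∀ k, MeasurableSpace (Ω k)]
    (μ : ∀ k, Measure (Ω k)) (T : ∀ k, Ω k → ℝ) : Prop :=
  ∀ η : ℝ, 0 < η → Tendsto (fun k => μ k {ω | η ≤ T k ω}) atTop (𝓝 0)

end

end NIECE

open NIECE

namespace NIECE

/-! Write `U = Aᵀ * A`, where `A` is the cross-covariance matrix or its transpose; `U` and `Aᵀ` have
the same column space. The first `d` eigenvalues of `M` are simple, so a reducing subspace either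
contains or is orthogonal to each `v j`. Hence an envelope inside the span of the `v j` is spanned
by those with nonzero score `‖A (v j)‖ ^ 2` (`envelope_eq_span`). So `u` counts the nonzero scores
and `Δ_U` is the smallest of them.

The deterministic core is `exists_forall_frobNorm_projMatrix_sub_lt`. Suppose `M` and `A` are
perturbed by less than a small constant times `min 1 Δ_U` in Frobenius norm. Weyl and Davis–Kahan
keep each top eigenvector close up to sign. Since `A` has bounded operator norm (Schur's test and
the bound on `‖·‖₁`), each score moves by at most `Δ_U / 4`. The procedure therefore selects exactly
the right indices, and the two projections are sums of nearby rank-one projections.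

On the probabilistic side, sub-Gaussian tails give uniform fourth moments. Chebyshev then bounds the
Frobenius error of an `a × b` sample covariance by order `√(ab/n)` in probability. The dimension
factor `pr` in the rate condition dominates `√(ab)` for every block used, so no exponential
concentration is needed. -/

/-! ### Perturbation of eigenvalues and eigenvectors -/

lemma exists_orthonormalBasis_sortedEigenvalue {m : ℕ} {M : Matrix (Fin m) (Fin m) ℝ}
    (hM : M.IsHermitian) : ∃ e : OrthonormalBasis (Fin m) ℝ (EuclideanSpace ℝ (Fin m)),
      ∀ i, Matrix.toEuclideanLin M (e i) = sortedEigenvalue M i • e i := by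
  have hT := Matrix.isSymmetric_toEuclideanLin_iff.mpr hM
  refine ⟨(hT.eigenvectorBasis finrank_euclideanSpace).reindex
    (finCongr (Fintype.card_fin m)), fun i => ?_⟩
  rw [OrthonormalBasis.reindex_apply, hT.apply_eigenvectorBasis]
  have : M.IsHermitian ∧ (i : ℕ) < m := ⟨hM, i.2⟩
  rw [sortedEigenvalue, dif_pos this]
  rfl

lemma sortedEigenvalue_antitone {m : ℕ} {M : Matrix (Fin m) (Fin m) ℝ} (hM : M.IsHermitian)
    {i j : ℕ} (hij : i ≤ j) (hj : j < m) : sortedEigenvalue M j ≤ sortedEigenvalue M i := by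
  rw [sortedEigenvalue, sortedEigenvalue, dif_pos ⟨hM, hj⟩, dif_pos ⟨hM, hij.trans_lt hj⟩]
  exact hM.eigenvalues₀_antitone hij

/-- For a self-adjoint operator with an orthonormal eigenbasis, the quadratic form is the weighted
sum of squared coordinates. -/
lemma inner_apply_eq_sum {ι E : Type*} [Fintype ι] [NormedAddCommGroup E] [InnerProductSpace ℝ E]
    (e : OrthonormalBasis ι ℝ E) (T : E →ₗ[ℝ] E) {l : ι → ℝ} (he : ∀ i, T (e i) = l i • e i)
    (x : E) : inner ℝ x (T x) = ∑ i, l i * inner ℝ (e i) x ^ 2 := by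
  conv_lhs => rw [← e.sum_repr' x]
  rw [map_sum, e.sum_repr' x, inner_sum]
  refine Finset.sum_congr rfl fun i _ => ?_
  rw [map_smul, he, real_inner_smul_right, real_inner_smul_right, real_inner_comm]
  ring

lemma inner_eq_zero_of_mem_span {ι E : Type*} [Fintype ι] [NormedAddCommGroup E]
    [InnerProductSpace ℝ E] (e : OrthonormalBasis ι ℝ E) {s : Set ι} {x : E}
    (hx : x ∈ Submodule.span ℝ (e '' s)) {i : ι} (hi : i ∉ s) : inner ℝ (e i) x = 0 := by
  induction hx using Submodule.span_induction with
  | mem y hy =>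
    obtain ⟨j, hj, rfl⟩ := hy
    exact e.orthonormal.2 (fun h => hi (h ▸ hj))
  | zero => simp
  | add y z _ _ hy hz => rw [inner_add_right, hy, hz, add_zero]
  | smul a y _ hy => rw [real_inner_smul_right, hy, mul_zero]

/-- Weyl's inequality, one-sided, in terms of ordered eigenbases. -/
lemma eigenvalue_le_add_of_norm_sub_le {m : ℕ} {E : Type*} [NormedAddCommGroup E]
    [InnerProductSpace ℝ E] (e f : OrthonormalBasis (Fin m) ℝ E) (S T : E →ₗ[ℝ] E)
    {k l : Fin m → ℝ} (hS : ∀ i, S (e i) = k i • e i) (hT : ∀ i, T (f i) = l i • f i)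
    (hk : Antitone k) (hl : Antitone l) {η : ℝ} (hST : ∀ x, ‖S x - T x‖ ≤ η * ‖x‖) (j : Fin m) :
    k j ≤ l j + η := by
  have : FiniteDimensional ℝ E := e.toBasis.finiteDimensional_of_finite
  have hcard : ∀ (g : OrthonormalBasis (Fin m) ℝ E) (s : Finset (Fin m)),
      Module.finrank ℝ (Submodule.span ℝ (g '' s)) = s.card := by
    intro g s
    have := finrank_span_eq_card (R := ℝ)
      (g.orthonormal.linearIndependent.comp ((↑) : s → Fin m) Subtype.val_injective)
    rw [Set.range_comp, Subtype.range_coe_subtype] at this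
    simpa using this
  -- The two spans have dimensions `j + 1` and `m - j`, which add up to `m + 1`, so they share a
  -- nonzero vector. On it the form of `S` is at least `k j` and that of `T` at most `l j`, per unit
  -- of squared norm.
  have hnd : ¬ Disjoint (Submodule.span ℝ (e '' (Finset.Iic j : Finset (Fin m))))
      (Submodule.span ℝ (f '' (Finset.Ici j : Finset (Fin m)))) := by
    intro h
    have := Submodule.finrank_add_finrank_le_of_disjoint h
    rw [hcard, hcard, Module.finrank_eq_card_basis e.toBasis] at this
    simp at this
    omega
  obtain ⟨x, hx1, hx2, hx0⟩ : ∃ x, x ∈ Submodule.span ℝ (e '' (Finset.Iic j : Finset (Fin m))) ∧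
      x ∈ Submodule.span ℝ (f '' (Finset.Ici j : Finset (Fin m))) ∧ x ≠ 0 := by
    by_contra! h
    exact hnd (Submodule.disjoint_def.2 fun x h1 h2 => h x h1 h2)
  have hxp : 0 < ‖x‖ ^ 2 := by positivity
  have h1 : k j * ‖x‖ ^ 2 ≤ inner ℝ x (S x) := by
    rw [inner_apply_eq_sum e S hS, ← e.sum_sq_norm_inner_right x, Finset.mul_sum]
    refine Finset.sum_le_sum fun i _ => ?_
    rw [Real.norm_eq_abs, sq_abs]
    by_cases hi : i ≤ j
    · exact mul_le_mul_of_nonneg_right (hk hi) (sq_nonneg _)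
    · rw [inner_eq_zero_of_mem_span e hx1 (by simpa using hi)]; simp
  have h2 : inner ℝ x (T x) ≤ l j * ‖x‖ ^ 2 := by
    rw [inner_apply_eq_sum f T hT, ← f.sum_sq_norm_inner_right x, Finset.mul_sum]
    refine Finset.sum_le_sum fun i _ => ?_
    rw [Real.norm_eq_abs, sq_abs]
    by_cases hi : j ≤ i
    · exact mul_le_mul_of_nonneg_right (hl hi) (sq_nonneg _)
    · rw [inner_eq_zero_of_mem_span f hx2 (by simpa using hi)]; simp
  have h3 : inner ℝ x (S x) - inner ℝ x (T x) ≤ η * ‖x‖ ^ 2 := by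
    rw [← inner_sub_right]
    calc _ ≤ ‖x‖ * ‖S x - T x‖ := real_inner_le_norm _ _
      _ ≤ ‖x‖ * (η * ‖x‖) := by gcongr; exact hST x
      _ = _ := by ring
  nlinarith

lemma abs_sortedEigenvalue_sub_le {m : ℕ} {M N : Matrix (Fin m) (Fin m) ℝ} (hM : M.IsHermitian)
    (hN : N.IsHermitian) {η : ℝ}
    (h : ∀ x, ‖Matrix.toEuclideanLin M x - Matrix.toEuclideanLin N x‖ ≤ η * ‖x‖) {j : ℕ}
    (hj : j < m) : |sortedEigenvalue M j - sortedEigenvalue N j| ≤ η := by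
  obtain ⟨e, he⟩ := exists_orthonormalBasis_sortedEigenvalue hM
  obtain ⟨f, hf⟩ := exists_orthonormalBasis_sortedEigenvalue hN
  have hk : Antitone fun i : Fin m => sortedEigenvalue M i :=
    fun a b hab => sortedEigenvalue_antitone hM hab b.2
  have hl : Antitone fun i : Fin m => sortedEigenvalue N i :=
    fun a b hab => sortedEigenvalue_antitone hN hab b.2
  have h1 := eigenvalue_le_add_of_norm_sub_le e f _ _ he hf hk hl h ⟨j, hj⟩
  have h2 := eigenvalue_le_add_of_norm_sub_le f e _ _ hf he hl hk
    (fun x => by rw [norm_sub_rev]; exact h x) ⟨j, hj⟩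
  simp only at h1 h2
  rw [abs_le]
  constructor <;> linarith

/-- Only consecutive gaps starting at an index below `d` are controlled. The gap just above or just
below position `j` suffices, since monotonicity carries it to every other `i`. -/
lemma le_abs_sortedEigenvalue_sub {m d : ℕ} {M : Matrix (Fin m) (Fin m) ℝ} (hM : M.IsHermitian)
    {δ : ℝ} (hgap : (δ : EReal) ≤ minEigenGap M d) {i j : ℕ} (hi : i < m)
    (hjm : j < m) (hj : j < d) (hij : i ≠ j) :
    δ ≤ |sortedEigenvalue M i - sortedEigenvalue M j| := by
  have key : ∀ a, a < d → a + 1 < m → δ ≤ sortedEigenvalue M a - sortedEigenvalue M (a + 1) := by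
    intro a ha ha'
    have := hgap.trans (iInf_le _ (⟨a, ha⟩ : Fin d))
    rw [if_pos ha'] at this
    exact_mod_cast this
  rcases lt_or_gt_of_ne hij with h | h
  · obtain ⟨b, rfl⟩ : ∃ b, j = b + 1 := ⟨j - 1, by omega⟩
    have h1 := key b (by omega) hjm
    have h2 := sortedEigenvalue_antitone hM (i := i) (j := b) (by omega) (by omega)
    exact le_trans (by linarith) (le_abs_self _)
  · have h1 := key j hj (by omega)
    have h2 := sortedEigenvalue_antitone hM (i := j + 1) (j := i) (by omega) (by omega)
    exact le_trans (by linarith) (neg_le_abs _)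

/-- Davis–Kahan for a simple eigenvalue: an approximate eigenvector is close to the line of the
eigenvector. -/
lemma sq_mul_one_sub_inner_sq_le {ι E : Type*} [Fintype ι] [DecidableEq ι] [NormedAddCommGroup E]
    [InnerProductSpace ℝ E] (e : OrthonormalBasis ι ℝ E) (T : E →ₗ[ℝ] E) (hT : T.IsSymmetric)
    {l : ι → ℝ}
    (he : ∀ i, T (e i) = l i • e i) {x : E} (hx : ‖x‖ = 1) {μ γ η : ℝ} {j : ι} (hγ : 0 ≤ γ)
    (hgap : ∀ i, i ≠ j → γ ≤ |l i - μ|) (hres : ‖T x - μ • x‖ ≤ η) :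
    γ ^ 2 * (1 - inner ℝ (e j) x ^ 2) ≤ η ^ 2 := by
  have hc : ∀ i, inner ℝ (e i) (T x - μ • x) = (l i - μ) * inner ℝ (e i) x := by
    intro i
    rw [inner_sub_right, ← hT, he, real_inner_smul_left, real_inner_smul_right]
    ring
  have h1 : ‖T x - μ • x‖ ^ 2 ≤ η ^ 2 := by gcongr
  refine le_trans ?_ h1
  have h2 := e.sum_sq_norm_inner_right x
  rw [← e.sum_sq_norm_inner_right, ← one_pow (M := ℝ) 2, ← hx, ← h2]
  simp only [Real.norm_eq_abs, sq_abs, hc]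
  -- By Parseval, `1 - ⟪e j, x⟫ ^ 2` is the mass of `x` off `e j`, and the residual multiplies each
  -- of those coordinates by at least `γ` in absolute value.
  rw [← Finset.sum_erase_add _ _ (Finset.mem_univ j), add_sub_cancel_right, Finset.mul_sum,
    ← Finset.sum_erase_add _ _ (Finset.mem_univ j)]
  refine le_add_of_le_of_nonneg (Finset.sum_le_sum fun i hi => ?_) (sq_nonneg _)
  rw [mul_pow, ← sq_abs (l i - μ)]
  have := hgap i (Finset.ne_of_mem_erase hi)
  gcongr

/-- The `j`-th eigenvectors of two close symmetric matrices are close up to sign. -/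
lemma exists_sign_norm_sub_le {m d : ℕ} {M N : Matrix (Fin m) (Fin m) ℝ} (hM : M.IsHermitian)
    (hN : N.IsHermitian) {δ η : ℝ} (hδ : 0 < δ) (hgap : (δ : EReal) ≤ minEigenGap M d)
    (hη : η ≤ δ / 2)
    (h : ∀ x, ‖Matrix.toEuclideanLin N x - Matrix.toEuclideanLin M x‖ ≤ η * ‖x‖)
    {v w : Fin d → EuclideanSpace ℝ (Fin m)} (hv : IsTopEigenvectors M v)
    (hw : IsTopEigenvectors N w) (j : Fin d) :
    ∃ s : ℝ, s ^ 2 = 1 ∧ ‖w j - s • v j‖ ≤ 3 * η / δ := by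
  have hdm : d ≤ m := by
    simpa using hv.1.linearIndependent.fintype_card_le_finrank
  have hjm : (j : ℕ) < m := j.2.trans_le hdm
  have hη0 : 0 ≤ η := by
    have := (norm_nonneg _).trans (h (w j))
    rwa [hw.1.1 j, mul_one] at this
  obtain ⟨e, he⟩ := exists_orthonormalBasis_sortedEigenvalue hM
  have hT := Matrix.isSymmetric_toEuclideanLin_iff.mpr hM
  have hweyl := abs_sortedEigenvalue_sub_le hN hM h hjm
  have hg : ∀ i : Fin m, i ≠ ⟨j, hjm⟩ → δ ≤ |sortedEigenvalue M i - sortedEigenvalue M j| :=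
    fun i hi => le_abs_sortedEigenvalue_sub hM hgap i.2 hjm j.2 (fun h => hi (Fin.ext h))
  -- Zero residual: the exact eigenvector `v j` must be `± e j`.
  have h1 := sq_mul_one_sub_inner_sq_le e _ hT he (hv.1.1 j) (j := ⟨j, hjm⟩) hδ.le hg (η := 0)
    (by rw [hv.2 j]; simp)
  -- By Weyl the eigenvalue of `N` moves by at most `η ≤ δ / 2`, so half of the gap survives.
  have h2 := sq_mul_one_sub_inner_sq_le e _ hT he (hw.1.1 j) (j := ⟨j, hjm⟩)
    (μ := sortedEigenvalue N j) (γ := δ / 2) (η := η)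
    (by positivity) (fun i hi => by
      have := hg i hi
      have h3 := abs_sub_le (sortedEigenvalue M i) (sortedEigenvalue N j) (sortedEigenvalue M j)
      linarith) (by
      rw [← hw.2 j, norm_sub_rev]
      simpa [hw.1.1 j] using h (w j))
  set f := e ⟨j, hjm⟩ with hf
  set a := inner ℝ f (v j) with ha
  set b := inner ℝ f (w j) with hb
  have hf1 : ‖f‖ = 1 := e.orthonormal.1 _
  have ha1 : |a| ≤ 1 := by simpa [hf1, hv.1.1 j] using abs_real_inner_le_norm f (v j)
  have hb1 : |b| ≤ 1 := by simpa [hf1, hw.1.1 j] using abs_real_inner_le_norm f (w j)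
  have ha2 : a ^ 2 = 1 := by
    have : a ^ 2 ≤ 1 := by rw [← sq_abs]; nlinarith [abs_nonneg a]
    have : 0 < δ ^ 2 := by positivity
    nlinarith
  have hva : v j = a • f := by
    rw [← sub_eq_zero, ← norm_eq_zero, ← sq_eq_zero_iff, norm_sub_sq_real, real_inner_smul_right,
      real_inner_comm, ← ha, norm_smul, hf1, hv.1.1 j, Real.norm_eq_abs, mul_one, sq_abs]
    linarith
  obtain ⟨t, ht, htb⟩ : ∃ t : ℝ, t ^ 2 = 1 ∧ t * b = |b| := by
    rcases abs_choice b with h | h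
    · exact ⟨1, by norm_num, by rw [h]; ring⟩
    · exact ⟨-1, by norm_num, by rw [h]; ring⟩
  refine ⟨t * a, by rw [mul_pow, ht, ha2, one_mul], ?_⟩
  have e1 : (t * a) • v j = t • f := by
    rw [hva, smul_smul, mul_assoc, ← sq, ha2, mul_one]
  rw [e1, le_div_iff₀ hδ]
  have e2 : ‖w j - t • f‖ ^ 2 = 2 - 2 * |b| := by
    rw [norm_sub_sq_real, real_inner_smul_right, real_inner_comm, ← hb, htb, norm_smul, hf1,
      hw.1.1 j, Real.norm_eq_abs, mul_one, sq_abs, ht]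
    ring
  have e3 : 2 - 2 * |b| ≤ 2 * (1 - b ^ 2) := by
    rw [← sq_abs b]; nlinarith [abs_nonneg b]
  -- `δ² ‖w j - t • f‖² ≤ 2 δ² (1 - b²) ≤ 8 η² ≤ (3 η)²`, whence the constant 3.
  refine le_of_sq_le_sq ?_ (by positivity)
  rw [mul_pow, e2]
  nlinarith [sq_nonneg δ, sq_nonneg η, mul_le_mul_of_nonneg_right e3 (sq_nonneg δ)]

/-! ### Matrix norms -/

lemma frobNorm_eq_norm {a b : ℕ} (A : Matrix (Fin a) (Fin b) ℝ) :
    frobNorm A = ‖(WithLp.toLp 2 fun x : Fin a × Fin b => A x.1 x.2 : EuclideanSpace ℝ _)‖ := by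
  rw [EuclideanSpace.norm_eq, frobNorm, Fintype.sum_prod_type]
  simp

lemma frobNorm_sq {a b : ℕ} (A : Matrix (Fin a) (Fin b) ℝ) :
    frobNorm A ^ 2 = ∑ i, ∑ j, A i j ^ 2 :=
  Real.sq_sqrt (by positivity)

lemma frobNorm_add_le {a b : ℕ} (A B : Matrix (Fin a) (Fin b) ℝ) :
    frobNorm (A + B) ≤ frobNorm A + frobNorm B := by
  simp only [frobNorm_eq_norm]
  exact norm_add_le (WithLp.toLp 2 fun x : Fin a × Fin b => A x.1 x.2 : EuclideanSpace ℝ _)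
    (WithLp.toLp 2 fun x : Fin a × Fin b => B x.1 x.2 : EuclideanSpace ℝ _)

lemma frobNorm_neg {a b : ℕ} (A : Matrix (Fin a) (Fin b) ℝ) : frobNorm (-A) = frobNorm A := by
  simp [frobNorm]

lemma frobNorm_sum_le {a b : ℕ} {ι : Type*} (s : Finset ι) (A : ι → Matrix (Fin a) (Fin b) ℝ) :
    frobNorm (∑ i ∈ s, A i) ≤ ∑ i ∈ s, frobNorm (A i) := by
  refine Finset.le_sum_of_subadditive frobNorm ?_ frobNorm_add_le s A
  simp [frobNorm]

lemma frobNorm_vecMulVec {a b : ℕ} (x : EuclideanSpace ℝ (Fin a)) (y : EuclideanSpace ℝ (Fin b)) :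
    frobNorm (vecMulVec x y) = ‖x‖ * ‖y‖ := by
  rw [frobNorm, EuclideanSpace.norm_eq, EuclideanSpace.norm_eq,
    ← Real.sqrt_mul (by positivity), Finset.sum_mul_sum]
  simp [vecMulVec_apply, mul_pow]

lemma norm_toEuclideanLin_le_frobNorm {a b : ℕ} (A : Matrix (Fin a) (Fin b) ℝ)
    (x : EuclideanSpace ℝ (Fin b)) : ‖Matrix.toEuclideanLin A x‖ ≤ frobNorm A * ‖x‖ := by
  rw [frobNorm, EuclideanSpace.norm_eq, EuclideanSpace.norm_eq,
    ← Real.sqrt_mul (by positivity), Finset.sum_mul]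
  refine Real.sqrt_le_sqrt (Finset.sum_le_sum fun i _ => ?_)
  simpa [mulVec, dotProduct] using Finset.sum_mul_sq_le_sq_mul_sq Finset.univ (A i) x

lemma sum_abs_le_l1Norm {a b : ℕ} (A : Matrix (Fin a) (Fin b) ℝ) (j : Fin b) :
    ∑ i, |A i j| ≤ l1Norm A :=
  le_ciSup (f := fun j => ∑ i, |A i j|) (Set.finite_range _).bddAbove j

lemma l1Norm_nonneg {a b : ℕ} (A : Matrix (Fin a) (Fin b) ℝ) : 0 ≤ l1Norm A :=
  Real.iSup_nonneg fun _ => by positivity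

/-- Schur's test. -/
lemma norm_toEuclideanLin_le_of_l1Norm_le {a b : ℕ} {A : Matrix (Fin a) (Fin b) ℝ} {K : ℝ}
    (hK : 0 ≤ K) (h1 : l1Norm A ≤ K) (h2 : l1Norm Aᵀ ≤ K) (x : EuclideanSpace ℝ (Fin b)) :
    ‖Matrix.toEuclideanLin A x‖ ≤ K * ‖x‖ := by
  refine le_of_sq_le_sq ?_ (by positivity)
  rw [mul_pow, EuclideanSpace.norm_sq_eq, EuclideanSpace.norm_sq_eq]
  have hrow : ∀ i, ‖Matrix.toEuclideanLin A x i‖ ^ 2 ≤ K * ∑ j, |A i j| * ‖x j‖ ^ 2 := by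
    intro i
    have hi : ∑ j, |A i j| ≤ K := (sum_abs_le_l1Norm Aᵀ i).trans h2
    -- Cauchy–Schwarz with the weight split as `|a| = √|a| · √|a|`: one factor gives an absolute row
    -- sum, the other is later summed along columns.
    have hcs := Finset.sum_mul_sq_le_sq_mul_sq Finset.univ (fun j => √|A i j|)
      (fun j => √|A i j| * |x j|)
    have e1 : ‖Matrix.toEuclideanLin A x i‖ ≤ ∑ j, √|A i j| * (√|A i j| * |x j|) := by
      simp only [← mul_assoc, Real.mul_self_sqrt (abs_nonneg _), ← abs_mul]
      simpa [mulVec, dotProduct] using Finset.abs_sum_le_sum_abs (fun j => A i j * x j) Finset.univ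
    calc _ ≤ (∑ j, √|A i j| * (√|A i j| * |x j|)) ^ 2 := by gcongr
      _ ≤ (∑ j, |A i j|) * ∑ j, |A i j| * ‖x j‖ ^ 2 := by
        simpa [mul_pow, Real.sq_sqrt (abs_nonneg _)] using hcs
      _ ≤ _ := by gcongr
  calc _ ≤ ∑ i, K * ∑ j, |A i j| * ‖x j‖ ^ 2 := Finset.sum_le_sum fun i _ => hrow i
    _ = K * ∑ j, (∑ i, |A i j|) * ‖x j‖ ^ 2 := by
      rw [← Finset.mul_sum, Finset.sum_comm]; simp only [Finset.sum_mul]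
    _ ≤ K * ∑ j, K * ‖x j‖ ^ 2 := by
      gcongr with j
      exact (sum_abs_le_l1Norm A j).trans h1
    _ = _ := by rw [← Finset.mul_sum]; ring

/-! ### Projections and reducing subspaces -/

lemma toEuclideanLin_projMatrix {m : ℕ} (S : Submodule ℝ (EuclideanSpace ℝ (Fin m))) :
    Matrix.toEuclideanLin (projMatrix S) = S.starProjection.toLinearMap := by
  refine (EuclideanSpace.basisFun (Fin m) ℝ).toBasis.ext fun j => ?_
  ext i
  simp [projMatrix, Matrix.col]

lemma starProjection_span_image {E ι : Type*} [NormedAddCommGroup E] [InnerProductSpace ℝ E]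
    [FiniteDimensional ℝ E] {v : ι → E} (hv : Orthonormal ℝ v) (J : Finset ι) (x : E) :
    (Submodule.span ℝ (v '' J)).starProjection x = ∑ j ∈ J, inner ℝ (v j) x • v j := by
  refine Submodule.eq_starProjection_of_mem_of_inner_eq_zero ?_ ?_
  · exact Submodule.sum_mem _ fun j hj => Submodule.smul_mem _ _
      (Submodule.subset_span (Set.mem_image_of_mem v hj))
  · intro w hw
    induction hw using Submodule.span_induction with
    | mem y hy =>
      obtain ⟨j, hj, rfl⟩ := hy
      rw [inner_sub_left, hv.inner_left_sum _ hj, real_inner_comm]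
      simp
    | zero => simp
    | add y z _ _ hy hz => rw [inner_add_right, hy, hz, add_zero]
    | smul a y _ hy => rw [real_inner_smul_right, hy, mul_zero]

lemma projMatrix_span_image {m : ℕ} {ι : Type*} {v : ι → EuclideanSpace ℝ (Fin m)}
    (hv : Orthonormal ℝ v) (J : Finset ι) :
    projMatrix (Submodule.span ℝ (v '' J)) = ∑ j ∈ J, vecMulVec (v j) (v j) := by
  ext a b
  rw [projMatrix, Matrix.of_apply, starProjection_span_image hv, Matrix.sum_apply]
  simp [vecMulVec_apply, EuclideanSpace.inner_single_right, mul_comm]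

/-- Multiplying the block decomposition by the idempotent `P` on either side annihilates the
complementary block, so both products equal `P * M * P`. Conversely, commuting makes the
off-diagonal blocks vanish. -/
lemma isReducing_iff {m : ℕ} (M : Matrix (Fin m) (Fin m) ℝ)
    (R : Submodule ℝ (EuclideanSpace ℝ (Fin m))) :
    IsReducing M R ↔ projMatrix R * M = M * projMatrix R := by
  have hP : projMatrix R * projMatrix R = projMatrix R := by
    apply Matrix.toEuclideanLin.injective
    ext1 x
    have := congrArg (fun f => f x) R.isIdempotentElem_starProjection.eq
    rw [Matrix.toLpLin_mul_same, toEuclideanLin_projMatrix]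
    simpa using this
  rw [IsReducing]
  set P := projMatrix R
  constructor
  · intro h
    have h1 : P * M = P * M * P := by
      conv_lhs => rw [h]
      rw [mul_add]
      simp only [← mul_assoc, hP, mul_sub, mul_one, sub_self, zero_mul, add_zero]
    have h2 : M * P = P * M * P := by
      conv_lhs => rw [h]
      rw [add_mul]
      simp only [mul_assoc, hP, sub_mul, one_mul, sub_self, mul_zero, add_zero]
    rw [h1, h2]
  · intro h
    have h1 : P * M * P = P * M := by rw [mul_assoc, ← h, ← mul_assoc, hP]
    simp only [sub_mul, mul_sub, one_mul, mul_one, h1, ← h]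
    abel

lemma isReducing_iff_forall {m : ℕ} (M : Matrix (Fin m) (Fin m) ℝ)
    (R : Submodule ℝ (EuclideanSpace ℝ (Fin m))) :
    IsReducing M R ↔ ∀ x, R.starProjection (Matrix.toEuclideanLin M x) =
      Matrix.toEuclideanLin M (R.starProjection x) := by
  rw [isReducing_iff, ← Matrix.toEuclideanLin.injective.eq_iff, Matrix.toLpLin_mul_same,
    Matrix.toLpLin_mul_same, toEuclideanLin_projMatrix, LinearMap.ext_iff]
  rfl

/-! ### The envelope as a span of eigenvectors -/

/-- This identifies the kernel of `A` with the orthogonal complement of `colSpan Aᵀ`. -/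
lemma inner_col_eq {m q : ℕ} (A : Matrix (Fin q) (Fin m) ℝ) (x : EuclideanSpace ℝ (Fin m))
    (i : Fin q) :
    inner ℝ x (WithLp.toLp 2 fun a : Fin m => Aᵀ a i) = Matrix.toEuclideanLin A x i := by
  simp [PiLp.inner_apply, mulVec, dotProduct]

/-- As a squared norm, a score is nonnegative, vanishes only when `A (v j) = 0`, and is stable under
perturbation of `A` and `v j`. -/
lemma score_transpose_mul_self {m q d : ℕ} (A : Matrix (Fin q) (Fin m) ℝ)
    (v : Fin d → EuclideanSpace ℝ (Fin m)) (j : Fin d) :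
    score (Aᵀ * A) v j = ‖Matrix.toEuclideanLin A (v j)‖ ^ 2 := by
  rw [score, ← real_inner_self_eq_norm_sq]
  simp only [PiLp.inner_apply]
  have := Matrix.dotProduct_mulVec (v j).ofLp Aᵀ (A *ᵥ (v j).ofLp)
  rw [Matrix.vecMul_transpose] at this
  simpa [dotProduct, sq, mul_comm, Matrix.mulVec_mulVec] using this

/-- By symmetry, an eigenvector has no component along basis vectors of a different eigenvalue. The
gap makes all the others different, so both `x` and `v j` lie on the line of one basis vector. -/
lemma eq_smul_of_simple_eigenvalue {m d : ℕ} {M : Matrix (Fin m) (Fin m) ℝ} (hM : M.IsHermitian)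
    {δ : ℝ} (hδ : 0 < δ) (hgap : (δ : EReal) ≤ minEigenGap M d)
    {v : Fin d → EuclideanSpace ℝ (Fin m)} (hv : IsTopEigenvectors M v) (j : Fin d)
    {x : EuclideanSpace ℝ (Fin m)}
    (hx : Matrix.toEuclideanLin M x = sortedEigenvalue M j • x) : ∃ c : ℝ, x = c • v j := by
  have hjm : (j : ℕ) < m := j.2.trans_le (by
    simpa using hv.1.linearIndependent.fintype_card_le_finrank)
  obtain ⟨e, he⟩ := exists_orthonormalBasis_sortedEigenvalue hM
  have hT := Matrix.isSymmetric_toEuclideanLin_iff.mpr hM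
  have key : ∀ y, Matrix.toEuclideanLin M y = sortedEigenvalue M j • y →
      y = inner ℝ (e ⟨j, hjm⟩) y • e ⟨j, hjm⟩ := by
    intro y hy
    conv_lhs => rw [← e.sum_repr' y]
    refine Finset.sum_eq_single _ (fun i _ hi => ?_) (by simp)
    have h1 : (sortedEigenvalue M i - sortedEigenvalue M j) * inner ℝ (e i) y = 0 := by
      have := hT (e i) y
      rw [he, hy, real_inner_smul_left, real_inner_smul_right] at this
      linarith
    have h2 := le_abs_sortedEigenvalue_sub hM hgap i.2 hjm j.2 (fun h => hi (Fin.ext h))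
    rcases mul_eq_zero.1 h1 with h | h
    · rw [h, abs_zero] at h2; linarith
    · rw [h, zero_smul]
  have h1 := key x hx
  have h2 := key (v j) (hv.2 j)
  set c := inner ℝ (e ⟨j, hjm⟩) (v j)
  have hc : c ≠ 0 := by
    intro h
    rw [h, zero_smul] at h2
    exact hv.1.ne_zero j h2
  refine ⟨inner ℝ (e ⟨j, hjm⟩) x * c⁻¹, ?_⟩
  rw [h2, smul_smul, mul_assoc, inv_mul_cancel₀ hc, mul_one]
  exact h1

/-- An envelope inside the span of simple eigenvectors is spanned by the eigenvectors with
nonzero score. -/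
lemma envelope_eq_span {m q d : ℕ} {M : Matrix (Fin m) (Fin m) ℝ} (hM : M.IsHermitian)
    {δ : ℝ} (hδ : 0 < δ) (hgap : (δ : EReal) ≤ minEigenGap M d)
    {v : Fin d → EuclideanSpace ℝ (Fin m)} (hv : IsTopEigenvectors M v)
    (A : Matrix (Fin q) (Fin m) ℝ)
    (hE : envelope M Aᵀ ≤ Submodule.span ℝ (Set.range v)) :
    envelope M Aᵀ = Submodule.span ℝ
      (v '' (Finset.univ.filter fun j => score (Aᵀ * A) v j ≠ 0 : Finset (Fin d))) := by
  have hT := Matrix.isSymmetric_toEuclideanLin_iff.mpr hM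
  set J := (Finset.univ.filter fun j => score (Aᵀ * A) v j ≠ 0 : Finset (Fin d)) with hJ
  apply le_antisymm
  · refine sInf_le ⟨?_, ?_⟩
    · rw [isReducing_iff_forall]
      intro x
      rw [starProjection_span_image hv.1, starProjection_span_image hv.1, map_sum]
      refine Finset.sum_congr rfl fun j _ => ?_
      rw [← hT, hv.2, map_smul, hv.2, real_inner_smul_left, smul_smul, mul_comm]
    · rw [colSpan, Submodule.span_le]
      rintro _ ⟨i, rfl⟩
      have hmem : (WithLp.toLp 2 fun a : Fin m => Aᵀ a i) ∈ envelope M Aᵀ := by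
        rw [envelope, Submodule.mem_sInf]
        exact fun R hR => hR.2 (Submodule.subset_span ⟨i, rfl⟩)
      -- Each column of `Aᵀ` is expanded in the `v j`; its coefficients at indices of zero score
      -- vanish because `A (v j) = 0` there.
      have h2 := hE hmem
      rw [← Set.image_univ, ← Finset.coe_univ, ← Submodule.starProjection_eq_self_iff,
        starProjection_span_image hv.1] at h2
      change (WithLp.toLp 2 fun a : Fin m => Aᵀ a i) ∈ _
      rw [← h2]
      refine Submodule.sum_mem _ fun j _ => ?_
      by_cases hj : j ∈ J
      · exact Submodule.smul_mem _ _ (Submodule.subset_span (Set.mem_image_of_mem v hj))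
      · have h3 : score (Aᵀ * A) v j = 0 := by simpa [hJ] using hj
        rw [score_transpose_mul_self, sq_eq_zero_iff, norm_eq_zero] at h3
        rw [inner_col_eq, h3]
        simp
  · rw [envelope, Submodule.span_le]
    rintro _ ⟨j, hj, rfl⟩
    rw [SetLike.mem_coe, Submodule.mem_sInf]
    rintro R ⟨hR, hcol⟩
    rw [isReducing_iff_forall] at hR
    -- The projection onto `R` commutes with `M`, so it preserves the one-dimensional eigenspace of
    -- `v j`. If `c = 0`, then `v j` is orthogonal to `R`, hence to the columns of `Aᵀ`, and its
    -- score is zero; otherwise `v j ∈ R`.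
    obtain ⟨c, hc⟩ := eq_smul_of_simple_eigenvalue hM hδ hgap hv j (x := R.starProjection (v j))
      (by rw [← hR, hv.2, map_smul])
    by_cases hc0 : c = 0
    · exfalso
      rw [hc0, zero_smul] at hc
      have h3 : score (Aᵀ * A) v j ≠ 0 := by simpa [hJ] using hj
      apply h3
      rw [score_transpose_mul_self, sq_eq_zero_iff, norm_eq_zero]
      ext i
      rw [← inner_col_eq]
      have := R.starProjection_inner_eq_zero (v j) _ (hcol (Submodule.subset_span ⟨i, rfl⟩))
      rwa [hc, sub_zero] at this
    · have : v j = c⁻¹ • R.starProjection (v j) := by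
        rw [hc, smul_smul, inv_mul_cancel₀ hc0, one_smul]
      rw [this]
      exact R.smul_mem _ (R.starProjection_apply_mem _)

/-! ### Ordered scores -/

/-- If a rank `i < J.card` were held by an index outside `J`, all of `J` would be ranked strictly
before `i`, forcing `J.card ≤ i`. Ties inside `J` or inside its complement do not matter. -/
lemma image_lt_eq_of_antitone {d : ℕ} {f : Fin d → ℝ} {π : Equiv.Perm (Fin d)}
    (hf : Antitone fun j => f (π j)) {J : Finset (Fin d)}
    (hJ : ∀ j ∈ J, ∀ i ∉ J, f i < f j) :
    (Finset.univ.filter fun j : Fin d => (j : ℕ) < J.card).image π = J := by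
  have hcard : ((Finset.univ.filter fun j : Fin d => (j : ℕ) < J.card).image π).card = J.card := by
    rw [Finset.card_image_of_injective _ π.injective, Fin.card_filter_val_lt]
    exact min_eq_right (by simpa using J.card_le_univ)
  refine Finset.eq_of_subset_of_card_le ?_ hcard.ge
  intro a ha
  obtain ⟨i, hi, rfl⟩ := Finset.mem_image.1 ha
  simp only [Finset.mem_filter, Finset.mem_univ, true_and] at hi
  by_contra hni
  have hsub : J.image π.symm ⊆ Finset.Iio i := by
    intro b hb
    obtain ⟨a, ha, rfl⟩ := Finset.mem_image.1 hb
    rw [Finset.mem_Iio]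
    by_contra hle
    have h1 := hf (not_lt.1 hle)
    have h2 := hJ a ha _ hni
    simp only [Equiv.apply_symm_apply] at h1
    linarith
  have := Finset.card_le_card hsub
  rw [Finset.card_image_of_injective _ π.symm.injective, Fin.card_Iio] at this
  omega

/-- When the `u` nonzero scores are exactly the positive ones, the score gap is the smallest
nonzero score. -/
lemma scoreGap_pos_and_le {m d : ℕ} {U : Matrix (Fin m) (Fin m) ℝ}
    {v : Fin d → EuclideanSpace ℝ (Fin m)} (hnn : ∀ j, 0 ≤ score U v j)
    (hu : 1 ≤ (Finset.univ.filter fun j => score U v j ≠ 0).card) :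
    0 < scoreGap U v (Finset.univ.filter fun j => score U v j ≠ 0).card ∧
    ∀ j, score U v j ≠ 0 →
      scoreGap U v (Finset.univ.filter fun j => score U v j ≠ 0).card ≤ score U v j := by
  set J := Finset.univ.filter fun j => score U v j ≠ 0 with hJ
  have memJ : ∀ j, j ∈ J ↔ score U v j ≠ 0 := by simp [hJ]
  set τ := Tuple.sort (fun i => -score U v i) with hτ
  have hanti : Antitone fun j => score U v (τ j) := by
    intro a b hab
    simpa using Tuple.monotone_sort (fun i => -score U v i) hab
  have himg := image_lt_eq_of_antitone hanti (J := J) (fun j hj i hi => by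
    rw [memJ] at hj hi
    rw [not_not.1 hi]
    exact (hnn j).lt_of_ne' hj)
  have hmem : ∀ i, τ i ∈ J ↔ (i : ℕ) < J.card := by
    intro i
    conv_lhs => rw [← himg]
    simp
  have hud : J.card ≤ d := by simpa using J.card_le_univ
  have h1 : orderedScore U v J.card = score U v (τ ⟨J.card - 1, by omega⟩) := by
    rw [orderedScore, dif_pos ⟨hu, hud⟩]
  -- Rank `J.card + 1` sits at zero-based position `J.card`, the first one outside `J`; if it
  -- exceeds `d`, the default value 0 applies.
  have h2 : orderedScore U v (J.card + 1) = 0 := by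
    rw [orderedScore]
    split_ifs with h
    · by_contra hne
      rw [← hτ, ← Ne, ← memJ, hmem] at hne
      simp at hne
    · rfl
  rw [scoreGap, h1, h2, sub_zero]
  constructor
  · refine (hnn _).lt_of_ne' ?_
    rw [← memJ, hmem]
    change J.card - 1 < J.card
    omega
  · intro j hj
    rw [← memJ, ← himg, Finset.mem_image] at hj
    obtain ⟨i, hi, rfl⟩ := hj
    apply hanti
    simp only [Finset.mem_filter, Finset.mem_univ, true_and] at hi
    rw [Fin.le_def]
    simp only
    omega

lemma finrank_span_image {E ι : Type*} [NormedAddCommGroup E] [InnerProductSpace ℝ E]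
    {v : ι → E} (hv : Orthonormal ℝ v) (J : Finset ι) :
    Module.finrank ℝ (Submodule.span ℝ (v '' J)) = J.card := by
  have := finrank_span_eq_card (R := ℝ)
    (hv.linearIndependent.comp ((↑) : J → ι) Subtype.val_injective)
  rw [Set.range_comp, Subtype.range_coe_subtype] at this
  simpa using this

lemma scoreGap_pos {m q d : ℕ} {M : Matrix (Fin m) (Fin m) ℝ} (hM : M.IsHermitian)
    {δ : ℝ} (hδ : 0 < δ) (hgap : (δ : EReal) ≤ minEigenGap M d)
    {v : Fin d → EuclideanSpace ℝ (Fin m)} (hv : IsTopEigenvectors M v)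
    (A : Matrix (Fin q) (Fin m) ℝ)
    (hE : envelope M Aᵀ ≤ Submodule.span ℝ (Set.range v)) {u : ℕ}
    (hu : u = Module.finrank ℝ (envelope M Aᵀ)) (hu1 : 1 ≤ u) :
    0 < scoreGap (Aᵀ * A) v u := by
  rw [envelope_eq_span hM hδ hgap hv A hE, finrank_span_image hv.1] at hu
  rw [hu] at hu1 ⊢
  exact (scoreGap_pos_and_le (fun j => by rw [score_transpose_mul_self]; positivity) hu1).1

/-! ### Stability of scores and of the NIECE output -/

/-- Since `B y - s • A x = (B - A) y + A (y - s • x)`, the norms differ by at most `t * (1 + K *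
L)`; the sign `s` is invisible to them. The bound on the squares follows by factoring their
difference. -/
lemma abs_norm_sq_sub_le {m q : ℕ} (A B : Matrix (Fin q) (Fin m) ℝ) {K t L s : ℝ} (hK : 0 ≤ K)
    (hA : ∀ x, ‖Matrix.toEuclideanLin A x‖ ≤ K * ‖x‖) (hAB : frobNorm (B - A) ≤ t)
    {x y : EuclideanSpace ℝ (Fin m)} (hx : ‖x‖ = 1) (hy : ‖y‖ = 1) (hs : s ^ 2 = 1)
    (hxy : ‖y - s • x‖ ≤ t * L) :
    |‖Matrix.toEuclideanLin B y‖ ^ 2 - ‖Matrix.toEuclideanLin A x‖ ^ 2| ≤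
      t * (1 + K * L) * (2 * K + t * (1 + K * L)) := by
  have hs1 : |s| = 1 := by rwa [← sq_eq_sq₀ (abs_nonneg s) zero_le_one, sq_abs, one_pow]
  have h1 : ‖Matrix.toEuclideanLin B y - s • Matrix.toEuclideanLin A x‖ ≤ t * (1 + K * L) := by
    have : Matrix.toEuclideanLin B y - s • Matrix.toEuclideanLin A x =
        Matrix.toEuclideanLin (B - A) y + Matrix.toEuclideanLin A (y - s • x) := by
      rw [map_sub, map_sub, map_smul, LinearMap.sub_apply]; abel
    rw [this]
    calc _ ≤ _ := norm_add_le _ _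
      _ ≤ frobNorm (B - A) * ‖y‖ + K * ‖y - s • x‖ :=
        add_le_add (norm_toEuclideanLin_le_frobNorm _ _) (hA _)
      _ ≤ t * 1 + K * (t * L) := by rw [hy]; gcongr
      _ = _ := by ring
  have h2 : |‖Matrix.toEuclideanLin B y‖ - ‖Matrix.toEuclideanLin A x‖| ≤ t * (1 + K * L) := by
    have := abs_norm_sub_norm_le (Matrix.toEuclideanLin B y) (s • Matrix.toEuclideanLin A x)
    rw [norm_smul, Real.norm_eq_abs, hs1, one_mul] at this
    exact this.trans h1
  have h3 : ‖Matrix.toEuclideanLin A x‖ ≤ K := by simpa [hx] using hA x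
  set a := ‖Matrix.toEuclideanLin A x‖
  set b := ‖Matrix.toEuclideanLin B y‖
  have ha : 0 ≤ a := norm_nonneg _
  have hb : 0 ≤ b := norm_nonneg _
  have h4 : b ≤ K + t * (1 + K * L) := by linarith [(abs_le.1 h2).2]
  rw [sq_sub_sq, abs_mul, abs_of_nonneg (by positivity : 0 ≤ b + a), mul_comm]
  have h5 : 0 ≤ t * (1 + K * L) := (abs_nonneg _).trans h2
  exact mul_le_mul h2 (by linarith) (by positivity) h5

/-- The rank-one projection does not see the sign: as `s² = 1`, `y yᵀ - x xᵀ = y (y - s x)ᵀ + (y - s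
x) (s x)ᵀ`. -/
lemma frobNorm_vecMulVec_self_sub_le {m : ℕ} {x y : EuclideanSpace ℝ (Fin m)} (hx : ‖x‖ = 1)
    (hy : ‖y‖ = 1) {s : ℝ} (hs : s ^ 2 = 1) :
    frobNorm (vecMulVec (y : Fin m → ℝ) y - vecMulVec (x : Fin m → ℝ) x) ≤ 2 * ‖y - s • x‖ := by
  have hs1 : |s| = 1 := by rwa [← sq_eq_sq₀ (abs_nonneg s) zero_le_one, sq_abs, one_pow]
  have : vecMulVec (y : Fin m → ℝ) y - vecMulVec (x : Fin m → ℝ) x =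
      vecMulVec y (y - s • x).ofLp + vecMulVec (y - s • x).ofLp (s • x).ofLp := by
    ext a b
    simp only [Matrix.sub_apply, Matrix.add_apply, vecMulVec_apply, PiLp.sub_apply,
      PiLp.smul_apply, smul_eq_mul]
    linear_combination (x a * x b) * hs
  rw [this]
  refine (frobNorm_add_le _ _).trans ?_
  rw [frobNorm_vecMulVec, frobNorm_vecMulVec, norm_smul, hx, hy, Real.norm_eq_abs, hs1]
  linarith

/-- Deterministic stability of the NIECE procedure. -/
theorem exists_forall_frobNorm_projMatrix_sub_lt (d : ℕ) {δ K η : ℝ} (hδ : 0 < δ) (hK : 0 ≤ K)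
    (hη : 0 < η) : ∃ c : ℝ, 0 < c ∧ ∀ {m q : ℕ} {M N : Matrix (Fin m) (Fin m) ℝ}
    {A B : Matrix (Fin q) (Fin m) ℝ} {v : Fin d → EuclideanSpace ℝ (Fin m)} {u : ℕ}
    {S : Submodule ℝ (EuclideanSpace ℝ (Fin m))},
    M.IsHermitian → N.IsHermitian → (δ : EReal) ≤ minEigenGap M d →
    (∀ x, ‖Matrix.toEuclideanLin A x‖ ≤ K * ‖x‖) → IsTopEigenvectors M v →
    envelope M Aᵀ ≤ Submodule.span ℝ (Set.range v) →
    u = Module.finrank ℝ (envelope M Aᵀ) → 1 ≤ u → IsNIECEOutput N (Bᵀ * B) d u S →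
    frobNorm (N - M) < c * min 1 (scoreGap (Aᵀ * A) v u) →
    frobNorm (B - A) < c * min 1 (scoreGap (Aᵀ * A) v u) →
    frobNorm (projMatrix S - projMatrix (envelope M Aᵀ)) < η := by
  set L := 3 / δ with hL
  have hL0 : 0 < L := by positivity
  set G := 1 + K * L with hG
  have hG0 : 0 < G := by positivity
  -- The bound `δ / 2` is what Davis–Kahan needs; the bound 1 and the third one keep score errors
  -- below a quarter of the score gap; the last controls the sum of at most `d` projection errors.
  -- Using `d + 1` covers `d = 0` and gives a strict inequality.
  refine ⟨min (min 1 (δ / 2)) (min (1 / (4 * (G * (2 * K + G)))) (η / (2 * L * (d + 1)))),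
    by positivity, ?_⟩
  intro m q M N A B v u S hM hN hgap hA hv hE hu hu1 hS hMN hAB
  set c := min (min 1 (δ / 2)) (min (1 / (4 * (G * (2 * K + G)))) (η / (2 * L * (d + 1)))) with hc
  have hc0 : 0 < c := by positivity
  have hc1 : c ≤ 1 := (min_le_left _ _).trans (min_le_left _ _)
  have hc2 : c ≤ δ / 2 := (min_le_left _ _).trans (min_le_right _ _)
  have hc3 : c * (4 * (G * (2 * K + G))) ≤ 1 := by
    rw [← le_div_iff₀ (by positivity)]
    exact (min_le_right _ _).trans (min_le_left _ _)
  have hc4 : c * (2 * L * (d + 1)) ≤ η := by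
    rw [← le_div_iff₀ (by positivity)]
    exact (min_le_right _ _).trans (min_le_right _ _)
  have hDpos := scoreGap_pos hM hδ hgap hv A hE hu hu1
  rw [envelope_eq_span hM hδ hgap hv A hE, finrank_span_image hv.1] at hu
  rw [envelope_eq_span hM hδ hgap hv A hE]
  set J := (Finset.univ.filter fun j => score (Aᵀ * A) v j ≠ 0 : Finset (Fin d)) with hJ
  subst hu
  have hle := (scoreGap_pos_and_le (U := Aᵀ * A) (v := v)
    (fun j => by rw [score_transpose_mul_self]; positivity) hu1).2
  rw [← hJ] at hle
  set D := scoreGap (Aᵀ * A) v J.card with hD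
  set t := c * min 1 D with ht
  have ht0 : 0 < t := by positivity
  have htc : t ≤ c := mul_le_of_le_one_right hc0.le (min_le_left _ _)
  have htD : t ≤ c * D := mul_le_mul_of_nonneg_left (min_le_right _ _) hc0.le
  obtain ⟨w, π, hw, hanti, rfl⟩ := hS
  have hclose : ∀ j, ∃ s : ℝ, s ^ 2 = 1 ∧ ‖w j - s • v j‖ ≤ t * L := by
    intro j
    obtain ⟨s, hs, h⟩ := exists_sign_norm_sub_le hM hN hδ hgap (η := t) (by linarith)
      (fun x => by
        rw [← LinearMap.sub_apply, ← map_sub]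
        refine (norm_toEuclideanLin_le_frobNorm _ _).trans ?_
        gcongr) hv hw j
    refine ⟨s, hs, h.trans_eq ?_⟩
    rw [hL]; ring
  choose s hs hws using hclose
  have hscore : ∀ j, |score (Bᵀ * B) w j - score (Aᵀ * A) v j| ≤ D / 4 := by
    intro j
    rw [score_transpose_mul_self, score_transpose_mul_self]
    refine (abs_norm_sq_sub_le A B hK hA hAB.le (hv.1.1 j) (hw.1.1 j) (hs j)
      (hws j)).trans ?_
    rw [← hG]
    calc t * G * (2 * K + t * G) ≤ (c * D) * G * (2 * K + 1 * G) := by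
          gcongr; exact htc.trans hc1
      _ = (c * (4 * (G * (2 * K + G)))) * (D / 4) := by ring
      _ ≤ 1 * (D / 4) := by gcongr
      _ = _ := one_mul _
  -- Perturbed scores are at least `3D/4` on `J` and at most `D/4` off it.
  have himg := image_lt_eq_of_antitone hanti (J := J) (fun j hj i hi => by
    have hj' : score (Aᵀ * A) v j ≠ 0 := by simpa [hJ] using hj
    have hi' : score (Aᵀ * A) v i = 0 := by simpa [hJ] using hi
    have h1 := hle j hj'
    have h2 := abs_le.1 (hscore j)
    have h3 := abs_le.1 (hscore i)
    linarith [h2.1, h3.2])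
  have hset : (fun j => w (π j)) '' {j : Fin d | (j : ℕ) < J.card} = w '' (J : Set (Fin d)) := by
    conv_rhs => rw [← himg]
    rw [Finset.coe_image, ← Set.image_comp]
    simp
  rw [hset, projMatrix_span_image hw.1, projMatrix_span_image hv.1, ← Finset.sum_sub_distrib]
  calc _ ≤ ∑ j ∈ J, frobNorm (vecMulVec (w j : Fin m → ℝ) (w j) -
          vecMulVec (v j : Fin m → ℝ) (v j)) := frobNorm_sum_le _ _
    _ ≤ ∑ _j ∈ J, 2 * (t * L) := Finset.sum_le_sum fun j _ =>
        (frobNorm_vecMulVec_self_sub_le (hv.1.1 j) (hw.1.1 j) (hs j)).trans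
          (by gcongr; exact hws j)
    _ = J.card * (2 * (t * L)) := by rw [Finset.sum_const, nsmul_eq_mul]
    _ ≤ d * (2 * (t * L)) := by
        gcongr; exact_mod_cast (by simpa using J.card_le_univ : J.card ≤ d)
    _ < (d + 1) * (2 * (t * L)) := by
        have : 0 < t * L := by positivity
        linarith
    _ ≤ (d + 1) * (2 * (c * L)) := by gcongr
    _ = c * (2 * L * (d + 1)) := by ring
    _ ≤ η := hc4

/-! ### Moments of sub-Gaussian variables -/

/-- A bound for the fourth moment of a random variable with tails `2 exp (-t² / σ²)`. -/
noncomputable def fourthMomentBound (σ : ℝ) : ℝ :=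
  4 * ∫ t in Set.Ioi (0 : ℝ), 2 * (t ^ (3 : ℝ) * Real.exp (-(1 / σ ^ 2) * t ^ 2))

lemma fourthMomentBound_nonneg (σ : ℝ) : 0 ≤ fourthMomentBound σ := by
  refine mul_nonneg (by norm_num) (setIntegral_nonneg measurableSet_Ioi fun t ht => ?_)
  have : 0 < t := ht
  positivity

/-- Layer-cake formula: the fourth moment is `4 ∫ t³ P(|f| ≥ t) dt`. The extended-valued form also
yields integrability. -/
lemma lintegral_pow_four_le {Ω : Type*} [MeasurableSpace Ω] {μ : Measure Ω} [IsProbabilityMeasure μ]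
    {f : Ω → ℝ} (hf : AEMeasurable f μ) {σ : ℝ} (hσ : 0 < σ)
    (htail : ∀ t, 0 ≤ t → μ.real {ω | t ≤ |f ω|} ≤ 2 * Real.exp (-(t ^ 2 / σ ^ 2))) :
    ∫⁻ ω, ENNReal.ofReal (f ω ^ 4) ∂μ ≤ ENNReal.ofReal (fourthMomentBound σ) := by
  have h1 := lintegral_rpow_eq_lintegral_meas_le_mul μ (f := fun ω => |f ω|)
    (Eventually.of_forall fun ω => abs_nonneg _) hf.norm (p := 4) (by norm_num)
  have e : ∀ ω, |f ω| ^ (4 : ℝ) = f ω ^ 4 := by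
    intro ω
    rw [show (4 : ℝ) = ((4 : ℕ) : ℝ) by norm_num, Real.rpow_natCast, Even.pow_abs (by decide)]
  simp only [e] at h1
  rw [h1, fourthMomentBound, ENNReal.ofReal_mul (by norm_num)]
  gcongr
  rw [ofReal_integral_eq_lintegral_ofReal]
  · refine setLIntegral_mono_ae (by fun_prop) (Eventually.of_forall fun t ht => ?_)
    have ht0 : 0 < t := ht
    rw [← ofReal_measureReal, ← ENNReal.ofReal_mul measureReal_nonneg]
    refine ENNReal.ofReal_le_ofReal ?_
    have := htail t ht0.le
    calc _ ≤ (2 * Real.exp (-(t ^ 2 / σ ^ 2))) * t ^ ((4 : ℝ) - 1) := by gcongr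
      _ = _ := by
        rw [show -(1 / σ ^ 2) * t ^ 2 = -(t ^ 2 / σ ^ 2) by ring]
        norm_num
        ring
  · exact (integrableOn_rpow_mul_exp_neg_mul_sq (by positivity) (by norm_num)).const_mul 2
  · filter_upwards [ae_restrict_mem measurableSet_Ioi] with t ht
    have : 0 < t := ht
    simp only [Pi.zero_apply]
    positivity

/-! ### Sample covariances -/

/-- The second moment of an average of independent centred variables. -/
lemma integral_sq_average_le {Ω : Type*} [MeasurableSpace Ω] {μ : Measure Ω}
    [IsProbabilityMeasure μ] {n : ℕ} {Z : Fin n → Ω → ℝ} (hZ : ∀ s, MemLp (Z s) 2 μ)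
    (hind : Pairwise fun s t => IndepFun (Z s) (Z t) μ) (h0 : ∀ s, ∫ ω, Z s ω ∂μ = 0) {V : ℝ}
    (hV : ∀ s, ∫ ω, Z s ω ^ 2 ∂μ ≤ V) :
    MemLp (fun ω => (n : ℝ)⁻¹ * ∑ s, Z s ω) 2 μ ∧
    ∫ ω, ((n : ℝ)⁻¹ * ∑ s, Z s ω) ^ 2 ∂μ ≤ V / n := by
  have hS : MemLp (fun ω => ∑ s, Z s ω) 2 μ := memLp_finsetSum _ fun s _ => hZ s
  refine ⟨hS.const_mul _, ?_⟩
  have hS0 : ∫ ω, ∑ s, Z s ω ∂μ = 0 := by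
    rw [integral_finsetSum _ fun s _ => (hZ s).integrable (by norm_num)]
    simp [h0]
  have hvar := IndepFun.variance_sum (s := Finset.univ) (fun s _ => hZ s)
    (fun s _ t _ hst => hind hst)
  have h1 : ∀ s, Var[Z s; μ] ≤ V := fun s => by
    rw [variance_of_integral_eq_zero (hZ s).aemeasurable (h0 s)]
    exact hV s
  have h2 : ∫ ω, (∑ s, Z s ω) ^ 2 ∂μ ≤ n * V := by
    have := variance_of_integral_eq_zero hS.aemeasurable hS0
    rw [← this]
    have e : (fun ω => ∑ s, Z s ω) = ∑ s, Z s := by ext; simp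
    rw [e, hvar]
    calc _ ≤ ∑ _s : Fin n, V := Finset.sum_le_sum fun s _ => h1 s
      _ = _ := by simp
  simp only [mul_pow]
  rw [integral_const_mul]
  rcases Nat.eq_zero_or_pos n with rfl | hn
  · simp
  · have : (0 : ℝ) < n := by exact_mod_cast hn
    calc _ ≤ (n : ℝ)⁻¹ ^ 2 * (n * V) := by gcongr
      _ = _ := by field_simp

lemma sampleCrossCov_sub_const {n a b : ℕ} (hn : 0 < n) (x : Fin n → Fin a → ℝ)
    (y : Fin n → Fin b → ℝ) (c : Fin a → ℝ) (e : Fin b → ℝ) :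
    sampleCrossCov (fun s i => x s i - c i) (fun s j => y s j - e j) = sampleCrossCov x y := by
  have hn' : (n : ℝ) ≠ 0 := by exact_mod_cast hn.ne'
  have h : ∀ {l : ℕ} (z : Fin n → Fin l → ℝ) (k : Fin l → ℝ) i,
      sampleMean (fun s i => z s i - k i) i = sampleMean z i - k i := by
    intro l z k i
    simp only [sampleMean, Finset.sum_sub_distrib, Finset.sum_const, Finset.card_univ,
      Fintype.card_fin, nsmul_eq_mul]
    field_simp
  ext i j
  simp only [sampleCrossCov, Matrix.of_apply, h]
  congr 1
  exact Finset.sum_congr rfl fun s _ => by ring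

/-- The error splits into an average of i.i.d. terms, centred when `c` is the expected product, and
a rank-one product of sample means. -/
lemma sampleCrossCov_eq {n a b : ℕ} (hn : 0 < n) (x : Fin n → Fin a → ℝ)
    (y : Fin n → Fin b → ℝ) (i : Fin a) (j : Fin b) (c : ℝ) :
    sampleCrossCov x y i j - c =
      (n : ℝ)⁻¹ * ∑ s, (x s i * y s j - c) - sampleMean x i * sampleMean y j := by
  have hn' : (n : ℝ) ≠ 0 := by exact_mod_cast hn.ne'
  have hx : ∑ s, x s i = n * sampleMean x i := by rw [sampleMean]; field_simp
  have hy : ∑ s, y s j = n * sampleMean y j := by rw [sampleMean]; field_simp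
  simp only [sampleCrossCov, Matrix.of_apply, sub_mul, mul_sub, Finset.sum_sub_distrib,
    ← Finset.sum_mul, ← Finset.mul_sum, hx, hy, Finset.sum_const, Finset.card_univ,
    Fintype.card_fin, nsmul_eq_mul]
  field_simp
  ring

/-- Otherwise `‖D‖_F < t / 2` and `‖x‖ ‖y‖ ≤ (‖x‖² + ‖y‖²) / 2 < t / 2`. Bounding the product of
norms this way leaves only second moments of the means to control. -/
lemma le_frobNorm_sub_vecMulVec {a b : ℕ} {D : Matrix (Fin a) (Fin b) ℝ} {x : Fin a → ℝ}
    {y : Fin b → ℝ} {t : ℝ} (ht : 0 < t) (h : t ≤ frobNorm (D - vecMulVec x y)) :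
    t ^ 2 / 4 ≤ ∑ i, ∑ j, D i j ^ 2 ∨ t ≤ ∑ i, x i ^ 2 + ∑ j, y j ^ 2 := by
  by_contra! hcon
  rw [← frobNorm_sq] at hcon
  have h1 : frobNorm D < t / 2 := by
    refine lt_of_pow_lt_pow_left₀ 2 (by positivity) ?_
    linarith [hcon.1, (by ring : (t / 2) ^ 2 = t ^ 2 / 4)]
  have h2 := frobNorm_add_le D (-vecMulVec x y)
  have h3 := frobNorm_vecMulVec (WithLp.toLp 2 x) (WithLp.toLp 2 y)
  simp only at h3
  rw [frobNorm_neg, ← sub_eq_add_neg, h3] at h2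
  have h4 : ‖(WithLp.toLp 2 x : EuclideanSpace ℝ (Fin a))‖ ^ 2 = ∑ i, x i ^ 2 := by
    simp [EuclideanSpace.norm_sq_eq]
  have h5 : ‖(WithLp.toLp 2 y : EuclideanSpace ℝ (Fin b))‖ ^ 2 = ∑ i, y i ^ 2 := by
    simp [EuclideanSpace.norm_sq_eq]
  rw [← h4, ← h5] at hcon
  nlinarith [two_mul_le_add_sq ‖(WithLp.toLp 2 x : EuclideanSpace ℝ (Fin a))‖
    ‖(WithLp.toLp 2 y : EuclideanSpace ℝ (Fin b))‖, hcon.2]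

section

variable {Ω 𝓦 : Type*} [MeasurableSpace Ω] [MeasurableSpace 𝓦] {μ : Measure Ω}
  [IsProbabilityMeasure μ] {n a b : ℕ} {W : Ω → 𝓦} {Ws : Fin n → Ω → 𝓦}

lemma integral_sq_average_comp_le (hind : iIndepFun Ws μ) (hid : ∀ s, IdentDistrib (Ws s) W μ μ)
    {f : 𝓦 → ℝ} (hf : Measurable f) (hL : MemLp (fun ω => f (W ω)) 2 μ)
    (h0 : ∫ ω, f (W ω) ∂μ = 0) {V : ℝ} (hV : ∫ ω, f (W ω) ^ 2 ∂μ ≤ V) :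
    MemLp (fun ω => (n : ℝ)⁻¹ * ∑ s, f (Ws s ω)) 2 μ ∧
    ∫ ω, ((n : ℝ)⁻¹ * ∑ s, f (Ws s ω)) ^ 2 ∂μ ≤ V / n := by
  have hid' : ∀ s, IdentDistrib (fun ω => f (Ws s ω)) (fun ω => f (W ω)) μ μ :=
    fun s => (hid s).comp hf
  refine integral_sq_average_le (fun s => (hid' s).symm.memLp_snd hL)
    (fun s t hst => (hind.indepFun hst).comp hf hf) (fun s => (hid' s).integral_eq.trans h0)
    (fun s => ((hid' s).comp (measurable_id.pow_const 2)).integral_eq.trans_le hV)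

/-- Markov's inequality is applied to each of the two alternatives of `le_frobNorm_sub_vecMulVec`.
Independence gives every squared entry and every squared mean expectation at most `(1 + C) / n`,
using `f² ≤ 1 + f⁴` and, for products, `(g h)² ≤ (g⁴ + h⁴) / 2`. -/
lemma measure_le_frobNorm_sampleCrossCov_sub_le_of_centered (hn : 0 < n) (hind : iIndepFun Ws μ)
    (hid : ∀ s, IdentDistrib (Ws s) W μ μ) {g : 𝓦 → Fin a → ℝ} {h : 𝓦 → Fin b → ℝ}
    (hg : Measurable g) (hh : Measurable h) {C : ℝ}
    (hgi : ∀ i, Integrable (fun ω => g (W ω) i ^ 4) μ)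
    (hhi : ∀ j, Integrable (fun ω => h (W ω) j ^ 4) μ)
    (hgC : ∀ i, ∫ ω, g (W ω) i ^ 4 ∂μ ≤ C) (hhC : ∀ j, ∫ ω, h (W ω) j ^ 4 ∂μ ≤ C)
    (hg0 : ∀ i, ∫ ω, g (W ω) i ∂μ = 0) (hh0 : ∀ j, ∫ ω, h (W ω) j ∂μ = 0)
    (hW : AEMeasurable W μ) {t : ℝ} (ht : 0 < t) :
    μ {ω | t ≤ frobNorm (sampleCrossCov (fun s => g (Ws s ω)) (fun s => h (Ws s ω)) -
      crossCov μ (fun ω => g (W ω)) (fun ω => h (W ω)))} ≤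
    ENNReal.ofReal (4 * ((a * b) * (1 + C) / n) / t ^ 2 + ((a + b) * (1 + C) / n) / t) := by
  have hgm : ∀ i, Measurable fun w => g w i := fun i => (measurable_pi_apply i).comp hg
  have hhm : ∀ j, Measurable fun w => h w j := fun j => (measurable_pi_apply j).comp hh
  have sq_int : ∀ {f : Ω → ℝ}, AEStronglyMeasurable f μ → Integrable (fun ω => f ω ^ 4) μ →
      Integrable (fun ω => f ω ^ 2) μ := by
    intro f hf hf4
    refine ((integrable_const (1 : ℝ)).add hf4).mono' (hf.pow 2) (Eventually.of_forall fun ω => ?_)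
    rw [Real.norm_eq_abs, abs_of_nonneg (sq_nonneg _), Pi.add_apply]
    nlinarith [sq_nonneg (f ω ^ 2 - 1), sq_nonneg (f ω ^ 2)]
  have sq_le : ∀ {f : Ω → ℝ}, AEStronglyMeasurable f μ → Integrable (fun ω => f ω ^ 4) μ →
      ∫ ω, f ω ^ 4 ∂μ ≤ C → ∫ ω, f ω ^ 2 ∂μ ≤ 1 + C := by
    intro f hf hf4 hC
    calc _ ≤ ∫ ω, (1 + f ω ^ 4) ∂μ := by
          refine integral_mono (sq_int hf hf4) ((integrable_const _).add hf4) fun ω => ?_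
          simp only
          nlinarith [sq_nonneg (f ω ^ 2 - 1), sq_nonneg (f ω ^ 2)]
      _ = 1 + ∫ ω, f ω ^ 4 ∂μ := by
          rw [integral_add (integrable_const _) hf4]; simp
      _ ≤ _ := by linarith
  have hgs : ∀ i, AEStronglyMeasurable (fun ω => g (W ω) i) μ :=
    fun i => ((hgm i).comp_aemeasurable hW).aestronglyMeasurable
  have hhs : ∀ j, AEStronglyMeasurable (fun ω => h (W ω) j) μ :=
    fun j => ((hhm j).comp_aemeasurable hW).aestronglyMeasurable
  have hgbar := fun i => integral_sq_average_comp_le hind hid (hgm i)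
    ((memLp_two_iff_integrable_sq (hgs i)).2 (sq_int (hgs i) (hgi i))) (hg0 i)
    (sq_le (hgs i) (hgi i) (hgC i))
  have hhbar := fun j => integral_sq_average_comp_le hind hid (hhm j)
    ((memLp_two_iff_integrable_sq (hhs j)).2 (sq_int (hhs j) (hhi j))) (hh0 j)
    (sq_le (hhs j) (hhi j) (hhC j))
  set c : Fin a → Fin b → ℝ := fun i j => ∫ ω, g (W ω) i * h (W ω) j ∂μ with hc
  have hprod : ∀ i j, MemLp (fun ω => g (W ω) i * h (W ω) j) 2 μ ∧
      ∫ ω, (g (W ω) i * h (W ω) j) ^ 2 ∂μ ≤ C := by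
    intro i j
    have hle : ∀ ω, (g (W ω) i * h (W ω) j) ^ 2 ≤ (g (W ω) i ^ 4 + h (W ω) j ^ 4) / 2 := by
      intro ω
      nlinarith [sq_nonneg (g (W ω) i ^ 2 - h (W ω) j ^ 2)]
    have hint := ((hgi i).add (hhi j)).div_const 2
    have hI : Integrable (fun ω => (g (W ω) i * h (W ω) j) ^ 2) μ :=
      hint.mono' (((hgs i).mul (hhs j)).pow 2) (Eventually.of_forall fun ω => by
        rw [Real.norm_eq_abs, abs_of_nonneg (sq_nonneg _)]; exact hle ω)
    refine ⟨(memLp_two_iff_integrable_sq ((hgs i).mul (hhs j))).2 hI, ?_⟩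
    calc _ ≤ ∫ ω, (g (W ω) i ^ 4 + h (W ω) j ^ 4) / 2 ∂μ := integral_mono hI hint hle
      _ = (∫ ω, g (W ω) i ^ 4 ∂μ + ∫ ω, h (W ω) j ^ 4 ∂μ) / 2 := by
        rw [integral_div, integral_add (hgi i) (hhi j)]
      _ ≤ C := by linarith [hgC i, hhC j]
  have hD := fun i j => integral_sq_average_comp_le hind hid
    (f := fun w => g w i * h w j - c i j) (V := 1 + C) (((hgm i).mul (hhm j)).sub_const _)
    ((hprod i j).1.sub (memLp_const _))
    (by rw [integral_sub ((hprod i j).1.integrable (by norm_num)) (integrable_const _)]; simp [hc])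
    (by
      have h1 := variance_le_expectation_sq (hprod i j).1.aestronglyMeasurable
      rw [variance_eq_integral (hprod i j).1.aemeasurable] at h1
      simp only [Pi.pow_apply] at h1
      linarith [(hprod i j).2])
  set D : Ω → Matrix (Fin a) (Fin b) ℝ := fun ω => Matrix.of fun i j =>
    (n : ℝ)⁻¹ * ∑ s, (g (Ws s ω) i * h (Ws s ω) j - c i j)
  have hsub : {ω | t ≤ frobNorm (sampleCrossCov (fun s => g (Ws s ω)) (fun s => h (Ws s ω)) -
      crossCov μ (fun ω => g (W ω)) (fun ω => h (W ω)))} ⊆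
      {ω | t ^ 2 / 4 ≤ ∑ i, ∑ j, D ω i j ^ 2} ∪
      {ω | t ≤ ∑ i, ((n : ℝ)⁻¹ * ∑ s, g (Ws s ω) i) ^ 2 +
        ∑ j, ((n : ℝ)⁻¹ * ∑ s, h (Ws s ω) j) ^ 2} := by
    intro ω hω
    refine le_frobNorm_sub_vecMulVec ht (hω.trans_eq (congrArg frobNorm ?_))
    ext i j
    rw [Matrix.sub_apply, Matrix.sub_apply, vecMulVec_apply]
    have : crossCov μ (fun ω => g (W ω)) (fun ω => h (W ω)) i j = c i j := by
      simp only [crossCov, Matrix.of_apply, covariance, hg0, hh0, sub_zero, hc]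
    rw [this, sampleCrossCov_eq hn]
    rfl
  have hDint : ∀ i j, Integrable (fun ω => D ω i j ^ 2) μ := fun i j => (hD i j).1.integrable_sq
  have hF1 : Integrable (fun ω => ∑ i, ∑ j, D ω i j ^ 2) μ :=
    integrable_finsetSum _ fun i _ => integrable_finsetSum _ fun j _ => hDint i j
  have hG := integrable_finsetSum Finset.univ fun i _ => (hgbar i).1.integrable_sq
  have hH := integrable_finsetSum Finset.univ fun j _ => (hhbar j).1.integrable_sq
  have hF1le : ∫ ω, ∑ i, ∑ j, D ω i j ^ 2 ∂μ ≤ (a * b) * (1 + C) / n := by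
    rw [integral_finsetSum _ fun i _ => integrable_finsetSum _ fun j _ => hDint i j]
    calc _ ≤ ∑ _i : Fin a, ∑ _j : Fin b, (1 + C) / n := by
          refine Finset.sum_le_sum fun i _ => ?_
          rw [integral_finsetSum _ fun j _ => hDint i j]
          exact Finset.sum_le_sum fun j _ => (hD i j).2
      _ = _ := by
          simp only [Finset.sum_const, Finset.card_univ, Fintype.card_fin, nsmul_eq_mul]; ring
  have hF2le : ∫ ω, (∑ i, ((n : ℝ)⁻¹ * ∑ s, g (Ws s ω) i) ^ 2 +
        ∑ j, ((n : ℝ)⁻¹ * ∑ s, h (Ws s ω) j) ^ 2) ∂μ ≤ (a + b) * (1 + C) / n := by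
    rw [integral_add hG hH, integral_finsetSum _ fun i _ => (hgbar i).1.integrable_sq,
      integral_finsetSum _ fun j _ => (hhbar j).1.integrable_sq]
    calc _ ≤ ∑ _i : Fin a, (1 + C) / n + ∑ _j : Fin b, (1 + C) / n :=
          add_le_add (Finset.sum_le_sum fun i _ => (hgbar i).2)
            (Finset.sum_le_sum fun j _ => (hhbar j).2)
      _ = _ := by
          simp only [Finset.sum_const, Finset.card_univ, Fintype.card_fin, nsmul_eq_mul]; ring
  have hM1 := mul_meas_ge_le_integral_of_nonneg
    (Eventually.of_forall fun ω => by positivity) hF1 (t ^ 2 / 4)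
  have hM2 := mul_meas_ge_le_integral_of_nonneg
    (Eventually.of_forall fun ω => by simp only [Pi.zero_apply, Pi.add_apply]; positivity)
    (hG.add hH) t
  refine (measure_mono hsub).trans ((measure_union_le _ _).trans ?_)
  rw [← ofReal_measureReal, ← ofReal_measureReal,
    ← ENNReal.ofReal_add measureReal_nonneg measureReal_nonneg]
  refine ENNReal.ofReal_le_ofReal (add_le_add ?_ ?_)
  · rw [le_div_iff₀ (by positivity)]
    linarith [hM1.trans hF1le]
  · rw [le_div_iff₀ ht, mul_comm]
    exact hM2.trans hF2le

lemma integrable_of_pow_four {f : Ω → ℝ} (hf : AEStronglyMeasurable f μ)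
    (h4 : Integrable (fun ω => f ω ^ 4) μ) : Integrable f μ := by
  refine ((integrable_const (1 : ℝ)).add h4).mono' hf (Eventually.of_forall fun ω => ?_)
  rw [Real.norm_eq_abs, Pi.add_apply]
  rw [← Even.pow_abs (by decide : Even 4) (f ω)]
  nlinarith [sq_nonneg (|f ω| ^ 2 - 1), sq_nonneg (|f ω| ^ 2), sq_nonneg (|f ω| - 1)]

lemma integral_pow_four_sub_le {f : Ω → ℝ} (hf : AEStronglyMeasurable f μ)
    (h4 : Integrable (fun ω => f ω ^ 4) μ) (c : ℝ) :
    Integrable (fun ω => (f ω - c) ^ 4) μ ∧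
      ∫ ω, (f ω - c) ^ 4 ∂μ ≤ 8 * ∫ ω, f ω ^ 4 ∂μ + 8 * c ^ 4 := by
  have hle : ∀ ω, (f ω - c) ^ 4 ≤ 8 * f ω ^ 4 + 8 * c ^ 4 := by
    intro ω
    have h1 : (f ω - c) ^ 2 ≤ 2 * (f ω ^ 2 + c ^ 2) := by nlinarith [sq_nonneg (f ω + c)]
    calc _ = ((f ω - c) ^ 2) ^ 2 := by ring
      _ ≤ (2 * (f ω ^ 2 + c ^ 2)) ^ 2 := by gcongr
      _ ≤ _ := by nlinarith [sq_nonneg (f ω ^ 2 - c ^ 2)]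
  have hint : Integrable (fun ω => 8 * f ω ^ 4 + 8 * c ^ 4) μ :=
    (h4.const_mul 8).add (integrable_const _)
  have hI : Integrable (fun ω => (f ω - c) ^ 4) μ :=
    hint.mono' ((hf.sub aestronglyMeasurable_const).pow 4) (Eventually.of_forall fun ω => by
      rw [Real.norm_eq_abs, abs_of_nonneg (by positivity)]; exact hle ω)
  refine ⟨hI, (integral_mono hI hint hle).trans_eq ?_⟩
  rw [integral_add (h4.const_mul 8) (integrable_const _), integral_const_mul]
  simp

lemma integral_pow_four_le {f : Ω → ℝ} (hf : AEStronglyMeasurable f μ)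
    (h4 : Integrable (fun ω => f ω ^ 4) μ) : (∫ ω, f ω ∂μ) ^ 4 ≤ ∫ ω, f ω ^ 4 ∂μ :=
  (Even.convexOn_pow (n := 4) (by decide)).map_integral_le (by fun_prop) isClosed_univ
    (by simp) (integrable_of_pow_four hf h4) h4

/-- Chebyshev's bound for the sample cross-covariance matrix in Frobenius norm. -/
lemma measure_le_frobNorm_sampleCrossCov_sub_le (hn : 0 < n) (hind : iIndepFun Ws μ)
    (hid : ∀ s, IdentDistrib (Ws s) W μ μ) {g : 𝓦 → Fin a → ℝ} {h : 𝓦 → Fin b → ℝ}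
    (hg : Measurable g) (hh : Measurable h) {C : ℝ}
    (hgi : ∀ i, Integrable (fun ω => g (W ω) i ^ 4) μ)
    (hhi : ∀ j, Integrable (fun ω => h (W ω) j ^ 4) μ)
    (hgC : ∀ i, ∫ ω, g (W ω) i ^ 4 ∂μ ≤ C) (hhC : ∀ j, ∫ ω, h (W ω) j ^ 4 ∂μ ≤ C)
    {t : ℝ} (ht : 0 < t) :
    μ {ω | t ≤ frobNorm (sampleCrossCov (fun s => g (Ws s ω)) (fun s => h (Ws s ω)) -
      crossCov μ (fun ω => g (W ω)) (fun ω => h (W ω)))} ≤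
    ENNReal.ofReal (4 * ((a * b) * (1 + 16 * C) / n) / t ^ 2 +
      ((a + b) * (1 + 16 * C) / n) / t) := by
  have hW : AEMeasurable W μ := (hid ⟨0, hn⟩).aemeasurable_snd
  have hgs : ∀ i, AEStronglyMeasurable (fun ω => g (W ω) i) μ := fun i =>
    (((measurable_pi_apply i).comp hg).comp_aemeasurable hW).aestronglyMeasurable
  have hhs : ∀ j, AEStronglyMeasurable (fun ω => h (W ω) j) μ := fun j =>
    (((measurable_pi_apply j).comp hh).comp_aemeasurable hW).aestronglyMeasurable
  set mg : Fin a → ℝ := fun i => ∫ ω, g (W ω) i ∂μ with hmg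
  set mh : Fin b → ℝ := fun j => ∫ ω, h (W ω) j ∂μ with hmh
  -- Centring costs a factor 16: `E (f - E f)⁴ ≤ 8 E f⁴ + 8 (E f)⁴`, and Jensen bounds the last term
  -- by `8 E f⁴`.
  have key := measure_le_frobNorm_sampleCrossCov_sub_le_of_centered hn hind hid
    (g := fun w i => g w i - mg i) (h := fun w j => h w j - mh j) (C := 16 * C)
    (measurable_pi_lambda _ fun i => ((measurable_pi_apply i).comp hg).sub_const _)
    (measurable_pi_lambda _ fun j => ((measurable_pi_apply j).comp hh).sub_const _)
    (fun i => (integral_pow_four_sub_le (hgs i) (hgi i) _).1)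
    (fun j => (integral_pow_four_sub_le (hhs j) (hhi j) _).1)
    (fun i => (integral_pow_four_sub_le (hgs i) (hgi i) _).2.trans (by
      linarith [hgC i, integral_pow_four_le (hgs i) (hgi i)]))
    (fun j => (integral_pow_four_sub_le (hhs j) (hhi j) _).2.trans (by
      linarith [hhC j, integral_pow_four_le (hhs j) (hhi j)]))
    (fun i => by
      rw [integral_sub (integrable_of_pow_four (hgs i) (hgi i)) (integrable_const _)]; simp [hmg])
    (fun j => by
      rw [integral_sub (integrable_of_pow_four (hhs j) (hhi j)) (integrable_const _)]; simp [hmh])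
    hW ht
  convert key using 7 with ω
  · rw [sampleCrossCov_sub_const hn]
  · ext i j
    simp only [crossCov, Matrix.of_apply]
    rw [covariance_sub_const_left (integrable_of_pow_four (hgs i) (hgi i)),
      covariance_sub_const_right (integrable_of_pow_four (hhs j) (hhi j))]

end

/-! ### Coordinate moments and the asymptotic argument -/

lemma JointSubGaussian.tail_left {Ω : Type*} [MeasurableSpace Ω] {μ : Measure Ω} {a b : ℕ}
    {X : Ω → Fin a → ℝ} {Y : Ω → Fin b → ℝ} {σ : ℝ} (h : JointSubGaussian μ X Y σ) (i : Fin a)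
    {t : ℝ} (ht : 0 ≤ t) :
    μ.real {ω | t ≤ |X ω i|} ≤ 2 * Real.exp (-(t ^ 2 / σ ^ 2)) := by
  simpa [PiLp.single_apply] using h (EuclideanSpace.single (Sum.inl i) 1) (by simp) t ht

lemma JointSubGaussian.tail_right {Ω : Type*} [MeasurableSpace Ω] {μ : Measure Ω} {a b : ℕ}
    {X : Ω → Fin a → ℝ} {Y : Ω → Fin b → ℝ} {σ : ℝ} (h : JointSubGaussian μ X Y σ) (j : Fin b)
    {t : ℝ} (ht : 0 ≤ t) :
    μ.real {ω | t ≤ |Y ω j|} ≤ 2 * Real.exp (-(t ^ 2 / σ ^ 2)) := by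
  simpa [PiLp.single_apply] using h (EuclideanSpace.single (Sum.inr j) 1) (by simp) t ht

lemma integrable_pow_four_of_tail {Ω : Type*} [MeasurableSpace Ω] {μ : Measure Ω}
    [IsProbabilityMeasure μ] {f : Ω → ℝ} (hf : AEMeasurable f μ) {σ : ℝ} (hσ : 0 < σ)
    (htail : ∀ t, 0 ≤ t → μ.real {ω | t ≤ |f ω|} ≤ 2 * Real.exp (-(t ^ 2 / σ ^ 2))) :
    Integrable (fun ω => f ω ^ 4) μ ∧ ∫ ω, f ω ^ 4 ∂μ ≤ fourthMomentBound σ := by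
  have h := lintegral_pow_four_le hf hσ htail
  have hnn : 0 ≤ᵐ[μ] fun ω => f ω ^ 4 := Eventually.of_forall fun ω => by
    simp only [Pi.zero_apply]; positivity
  have hm : AEStronglyMeasurable (fun ω => f ω ^ 4) μ := (hf.pow_const 4).aestronglyMeasurable
  refine ⟨⟨hm, ?_⟩, ?_⟩
  · rw [hasFiniteIntegral_iff_ofReal hnn]
    exact h.trans_lt ENNReal.ofReal_lt_top
  · rw [integral_eq_lintegral_of_nonneg_ae hnn hm]
    exact ENNReal.toReal_le_of_le_ofReal (fourthMomentBound_nonneg σ) h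

lemma crossCov_transpose {Ω : Type*} [MeasurableSpace Ω] {μ : Measure Ω} {a b : ℕ}
    (X : Ω → Fin a → ℝ) (Y : Ω → Fin b → ℝ) : (crossCov μ X Y)ᵀ = crossCov μ Y X := by
  ext i j
  simp only [crossCov, Matrix.transpose_apply, Matrix.of_apply]
  exact covariance_comm _ _

lemma sampleCrossCov_transpose {n a b : ℕ} (x : Fin n → Fin a → ℝ) (y : Fin n → Fin b → ℝ) :
    (sampleCrossCov x y)ᵀ = sampleCrossCov y x := by
  ext i j
  simp [sampleCrossCov, mul_comm]

/-- The Chebyshev bound vanishes asymptotically. -/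
lemma tendsto_chebyshev_bound {n : ℕ → ℕ} {a b : ℕ → ℕ} {q t : ℕ → ℝ} {V : ℝ} (hV : 0 ≤ V)
    (hn : ∀ᶠ k in atTop, 0 < n k) (ht : ∀ k, 0 < t k)
    (hab : ∀ᶠ k in atTop, (a k * b k : ℝ) ≤ q k ^ 2 ∧ (a k + b k : ℝ) ≤ 2 * q k)
    (hq : Tendsto (fun k => q k / (√(n k) * t k)) atTop (𝓝 0)) :
    Tendsto (fun k => ENNReal.ofReal (4 * ((a k * b k) * V / n k) / t k ^ 2 +
      ((a k + b k) * V / n k) / t k)) atTop (𝓝 0) := by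
  have hlim : Tendsto (fun k => ENNReal.ofReal (4 * V * (q k / (√(n k) * t k)) ^ 2 +
      2 * V * (q k / (√(n k) * t k)))) atTop (𝓝 0) := by
    have := ((hq.pow 2).const_mul (4 * V)).add (hq.const_mul (2 * V))
    simpa using ENNReal.tendsto_ofReal this
  refine tendsto_of_tendsto_of_tendsto_of_le_of_le' tendsto_const_nhds hlim
    (Eventually.of_forall fun _ => zero_le) ?_
  filter_upwards [hn, hab] with k hk habk
  refine ENNReal.ofReal_le_ofReal ?_
  have hn0 : (0 : ℝ) < n k := by exact_mod_cast hk
  have hn1 : (1 : ℝ) ≤ n k := by exact_mod_cast hk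
  have htk := ht k
  have hq0 : 0 ≤ q k := by
    have : (0 : ℝ) ≤ a k + b k := by positivity
    linarith [habk.2]
  have hsq : √(n k : ℝ) ^ 2 = n k := Real.sq_sqrt hn0.le
  -- The term linear in `1 / t` decays like `1 / n`; weakening this to `1 / √n` lets the ratio `q /
  -- (√n t)` control both terms.
  have hsle : √(n k : ℝ) ≤ n k :=
    Real.sqrt_le_iff.2 ⟨hn0.le, by nlinarith⟩
  refine add_le_add ?_ ?_
  · calc _ ≤ 4 * (q k ^ 2 * V / n k) / t k ^ 2 := by gcongr; exact habk.1
      _ = _ := by rw [div_pow, mul_pow, hsq]; field_simp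
  · calc _ ≤ (2 * q k * V / n k) / t k := by gcongr; exact habk.2
      _ ≤ (2 * q k * V / √(n k)) / t k := by gcongr
      _ = _ := by field_simp

/-- Consistency of the NIECE estimator built from sample covariances. -/
theorem tendstoZeroInProbability_niece {n m q : ℕ → ℕ} (hn : ∀ᶠ k in atTop, 0 < n k)
    (hm : ∀ᶠ k in atTop, 0 < m k) (hq : ∀ᶠ k in atTop, 0 < q k)
    {Ω 𝓦 : ℕ → Type*} [∀ k, MeasurableSpace (Ω k)] [∀ k, MeasurableSpace (𝓦 k)]
    {μ : ∀ k, Measure (Ω k)} [∀ k, IsProbabilityMeasure (μ k)]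
    {W : ∀ k, Ω k → 𝓦 k} {Ws : ∀ k, Fin (n k) → Ω k → 𝓦 k}
    (hind : ∀ k, iIndepFun (Ws k) (μ k)) (hid : ∀ k s, IdentDistrib (Ws k s) (W k) (μ k) (μ k))
    {g : ∀ k, 𝓦 k → Fin (m k) → ℝ} {h : ∀ k, 𝓦 k → Fin (q k) → ℝ}
    (hg : ∀ k, Measurable (g k)) (hh : ∀ k, Measurable (h k)) {C : ℝ} (hC : 0 ≤ C)
    (hgC : ∀ k, 0 < n k → ∀ i, Integrable (fun ω => g k (W k ω) i ^ 4) (μ k) ∧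
      ∫ ω, g k (W k ω) i ^ 4 ∂(μ k) ≤ C)
    (hhC : ∀ k, 0 < n k → ∀ i, Integrable (fun ω => h k (W k ω) i ^ 4) (μ k) ∧
      ∫ ω, h k (W k ω) i ^ 4 ∂(μ k) ≤ C)
    {M : ∀ k, Matrix (Fin (m k)) (Fin (m k)) ℝ} {A : ∀ k, Matrix (Fin (q k)) (Fin (m k)) ℝ}
    (hM : ∀ k, M k = crossCov (μ k) (fun ω => g k (W k ω)) (fun ω => g k (W k ω)))
    (hA : ∀ k, A k = crossCov (μ k) (fun ω => h k (W k ω)) (fun ω => g k (W k ω)))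
    {K : ℝ} (hK : 0 ≤ K) (hAK : ∀ k x, ‖Matrix.toEuclideanLin (A k) x‖ ≤ K * ‖x‖)
    {d : ℕ} {δ : ℝ} {u : ℕ → ℕ} {v : ∀ k, Fin d → EuclideanSpace ℝ (Fin (m k))}
    {Ehat : ∀ k, Ω k → Submodule ℝ (EuclideanSpace ℝ (Fin (m k)))}
    (hδ : 0 < δ) (hgap : ∀ k, (δ : EReal) ≤ minEigenGap (M k) d)
    (hv : ∀ k, IsTopEigenvectors (M k) (v k))
    (hE : ∀ k, envelope (M k) (A k)ᵀ ≤ Submodule.span ℝ (Set.range (v k)))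
    (hu : ∀ k, u k = Module.finrank ℝ (envelope (M k) (A k)ᵀ)) (hu1 : ∀ k, 1 ≤ u k)
    (hrate : Tendsto (fun k => (m k * q k : ℝ) / √(n k)) atTop (𝓝 0))
    (hrate' : Tendsto (fun k => (m k * q k : ℝ) * (scoreGap ((A k)ᵀ * A k) (v k) (u k))⁻¹ /
      √(n k)) atTop (𝓝 0))
    (hout : ∀ k ω, IsNIECEOutput
      (sampleCrossCov (fun s => g k (Ws k s ω)) (fun s => g k (Ws k s ω)))
      ((sampleCrossCov (fun s => h k (Ws k s ω)) (fun s => g k (Ws k s ω)))ᵀ *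
        sampleCrossCov (fun s => h k (Ws k s ω)) (fun s => g k (Ws k s ω))) d (u k) (Ehat k ω)) :
    TendstoZeroInProbability μ fun k ω =>
      frobNorm (projMatrix (Ehat k ω) - projMatrix (envelope (M k) (A k)ᵀ)) := by
  have hMh : ∀ k, (M k).IsHermitian := fun k => by
    rw [Matrix.IsHermitian, Matrix.conjTranspose_eq_transpose_of_trivial, hM, crossCov_transpose]
  have hD := fun k => scoreGap_pos (hMh k) hδ (hgap k) (hv k) (A k) (hE k) (hu k) (hu1 k)
  intro η hη
  obtain ⟨c, hc, hstab⟩ := exists_forall_frobNorm_projMatrix_sub_lt d hδ hK hη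
  set D : ℕ → ℝ := fun k => scoreGap ((A k)ᵀ * A k) (v k) (u k) with hDdef
  -- The stability radius of the deterministic theorem serves as the deviation threshold.
  set t : ℕ → ℝ := fun k => c * min 1 (D k) with htdef
  have ht : ∀ k, 0 < t k := fun k => mul_pos hc (lt_min one_pos (hD k))
  have hqt : Tendsto (fun k => (m k * q k : ℝ) / (√(n k) * t k)) atTop (𝓝 0) := by
    have hsum := (hrate.add hrate').const_mul c⁻¹
    simp only [add_zero, mul_zero] at hsum
    refine squeeze_zero (fun k => ?_) (fun k => ?_) hsum
    · have := ht k
      positivity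
    · have hDk : 0 < D k := hD k
      -- This separates the threshold into the two rates, without and with the inverse score gap.
      have hmin : (min 1 (D k))⁻¹ ≤ 1 + (D k)⁻¹ := by
        rcases min_choice 1 (D k) with h | h
        · rw [h]; simp [hDk.le]
        · rw [h]; linarith
      calc (m k * q k : ℝ) / (√(n k) * t k)
          = c⁻¹ * ((m k * q k : ℝ) / √(n k)) * (min 1 (D k))⁻¹ := by
            rw [htdef]; simp only [div_eq_mul_inv, mul_inv]; ring
        _ ≤ c⁻¹ * ((m k * q k : ℝ) / √(n k)) * (1 + (D k)⁻¹) := by gcongr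
        _ = _ := by rw [hDdef]; ring
  have hmq : ∀ᶠ k in atTop, (1 : ℝ) ≤ m k ∧ (1 : ℝ) ≤ q k := by
    filter_upwards [hm, hq] with k h1 h2
    exact ⟨by exact_mod_cast h1, by exact_mod_cast h2⟩
  have hV : (0 : ℝ) ≤ 1 + 16 * C := by positivity
  -- As `m, q ≥ 1`, the product `m * q` dominates both dimensions, so it also covers the `m × m`
  -- block.
  have lim1 := tendsto_chebyshev_bound (a := m) (b := m) hV hn ht (by
    filter_upwards [hmq] with k hk
    constructor
    · rw [← sq]; gcongr; nlinarith [hk.1, hk.2]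
    · nlinarith [hk.1, hk.2]) hqt
  have lim2 := tendsto_chebyshev_bound (a := q) (b := m) hV hn ht (by
    filter_upwards [hmq] with k hk
    have : (1 : ℝ) ≤ m k * q k := by nlinarith [hk.1, hk.2]
    constructor
    · nlinarith
    · nlinarith [hk.1, hk.2]) hqt
  have hlim := lim1.add lim2
  rw [add_zero] at hlim
  refine tendsto_of_tendsto_of_tendsto_of_le_of_le' tendsto_const_nhds hlim
    (Eventually.of_forall fun _ => zero_le) ?_
  filter_upwards [hn] with k hk
  have b1 := measure_le_frobNorm_sampleCrossCov_sub_le hk (hind k) (hid k) (hg k) (hg k)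
    (fun i => (hgC k hk i).1) (fun i => (hgC k hk i).1) (fun i => (hgC k hk i).2)
    (fun i => (hgC k hk i).2) (ht k)
  have b2 := measure_le_frobNorm_sampleCrossCov_sub_le hk (hind k) (hid k) (hh k) (hg k)
    (fun i => (hhC k hk i).1) (fun i => (hgC k hk i).1) (fun i => (hhC k hk i).2)
    (fun i => (hgC k hk i).2) (ht k)
  rw [← hM] at b1
  rw [← hA] at b2
  refine (measure_mono ?_).trans ((measure_union_le _ _).trans (add_le_add b1 b2))
  intro ω hω
  by_contra hcon
  rw [Set.mem_union, not_or] at hcon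
  refine (not_le.2 ?_ : ¬ η ≤ _) hω
  refine hstab (hMh k) ?_ (hgap k) (hAK k) (hv k) (hE k) (hu k) (hu1 k) (hout k ω)
    (not_le.1 hcon.1) (not_le.1 hcon.2)
  rw [Matrix.IsHermitian, Matrix.conjTranspose_eq_transpose_of_trivial, sampleCrossCov_transpose]

/-- The rate condition implies the rates without the logarithmic factor. -/
lemma tendsto_rates_of_isLittleO {n p r : ℕ → ℕ} {D : ℕ → ℝ} (hp : Tendsto p atTop atTop)
    (hr : Tendsto r atTop atTop) (hD : ∀ k, 0 < D k)
    (h : (fun k => max (p k * r k * √(Real.log (p k) + Real.log (r k)))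
          (p k * r k * (D k)⁻¹ * √(Real.log (p k) + Real.log (r k))))
        =o[atTop] fun k => √(n k : ℝ)) :
    Tendsto (fun k => (p k * r k : ℝ) / √(n k)) atTop (𝓝 0) ∧
    Tendsto (fun k => (p k * r k : ℝ) * (D k)⁻¹ / √(n k)) atTop (𝓝 0) := by
  have hlim := h.tendsto_div_nhds_zero
  have hlog : ∀ᶠ k in atTop, 1 ≤ √(Real.log (p k) + Real.log (r k)) := by
    -- `p ≥ 3 > e` makes the logarithmic factor at least 1, so it can be dropped.
    filter_upwards [hp.eventually_ge_atTop 3, hr.eventually_ge_atTop 1] with k h1 h2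
    rw [Real.one_le_sqrt]
    have h3 : 1 ≤ Real.log (p k) := by
      rw [Real.le_log_iff_exp_le (by positivity)]
      exact (Real.exp_one_lt_d9.le.trans (by norm_num)).trans
        (by exact_mod_cast h1 : (3 : ℝ) ≤ p k)
    have h4 : 0 ≤ Real.log (r k) := Real.log_natCast_nonneg _
    linarith
  constructor
  · refine squeeze_zero' (Eventually.of_forall fun k => by positivity) ?_ hlim
    filter_upwards [hlog] with k hk
    gcongr
    exact le_max_of_le_left (le_mul_of_one_le_right (by positivity) hk)
  · refine squeeze_zero' (Eventually.of_forall fun k => ?_) ?_ hlim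
    · have := hD k
      positivity
    filter_upwards [hlog] with k hk
    have := hD k
    gcongr
    exact le_max_of_le_right (le_mul_of_one_le_right (by positivity) hk)

end NIECE

theorem corollary1
    -- sample size and dimensions along the asymptotic sequence
    (n p r : ℕ → ℕ)
    (hn : Tendsto n atTop atTop) (hp : Tendsto p atTop atTop) (hr : Tendsto r atTop atTop)
    {Ω : ℕ → Type*} [∀ k, MeasurableSpace (Ω k)]
    (μ : ∀ k, Measure (Ω k)) [∀ k, IsProbabilityMeasure (μ k)]
    -- the linear model
    (X : ∀ k, Ω k → Fin (p k) → ℝ) (Y : ∀ k, Ω k → Fin (r k) → ℝ)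
    (ε : ∀ k, Ω k → Fin (r k) → ℝ)
    (α : ∀ k, Fin (r k) → ℝ) (β : ∀ k, Matrix (Fin (r k)) (Fin (p k)) ℝ)
    (hmodel : ∀ k, ∀ᵐ ω ∂(μ k), Y k ω = α k + β k *ᵥ X k ω + ε k ω)
    (hindep : ∀ k, IndepFun (X k) (ε k) (μ k))
    -- joint sub-Gaussian tails
    (σ : ℝ) (hσ : 0 < σ) (hsub : ∀ k, JointSubGaussian (μ k) (X k) (Y k) σ)
    -- i.i.d. data
    (Xs : ∀ k, Fin (n k) → Ω k → Fin (p k) → ℝ) (Ys : ∀ k, Fin (n k) → Ω k → Fin (r k) → ℝ)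
    (hiid : ∀ k, iIndepFun (fun i ω => (Xs k i ω, Ys k i ω)) (μ k))
    (hident : ∀ k i, IdentDistrib (fun ω => (Xs k i ω, Ys k i ω)) (fun ω => (X k ω, Y k ω))
      (μ k) (μ k))
    -- population covariance matrices
    (SX : ∀ k, Matrix (Fin (p k)) (Fin (p k)) ℝ) (hSX : ∀ k, SX k = crossCov (μ k) (X k) (X k))
    (SY : ∀ k, Matrix (Fin (r k)) (Fin (r k)) ℝ) (hSY : ∀ k, SY k = crossCov (μ k) (Y k) (Y k))
    (SXY : ∀ k, Matrix (Fin (p k)) (Fin (r k)) ℝ)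
    (hSXY : ∀ k, SXY k = crossCov (μ k) (X k) (Y k))
    -- sample covariance matrices
    (SXhat : ∀ k, Ω k → Matrix (Fin (p k)) (Fin (p k)) ℝ)
    (hSXhat : ∀ k ω, SXhat k ω = sampleCrossCov (fun i => Xs k i ω) (fun i => Xs k i ω))
    (SYhat : ∀ k, Ω k → Matrix (Fin (r k)) (Fin (r k)) ℝ)
    (hSYhat : ∀ k ω, SYhat k ω = sampleCrossCov (fun i => Ys k i ω) (fun i => Ys k i ω))
    (SXYhat : ∀ k, Ω k → Matrix (Fin (p k)) (Fin (r k)) ℝ)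
    (hSXYhat : ∀ k ω, SXYhat k ω = sampleCrossCov (fun i => Xs k i ω) (fun i => Ys k i ω))
    -- bounded cross-covariance
    (c₁ : ℝ) (hc₁ : ∀ k, l1Norm (SXY k) + l1Norm (SXY k)ᵀ < c₁) :
    -- response envelope: `M = Σ_Y`, `U = Σ_YX Σ_XY`
    (∀ (d : ℕ) (δ : ℝ) (u : ℕ → ℕ) (v : ∀ k, Fin d → EuclideanSpace ℝ (Fin (r k)))
        (Ehat : ∀ k, Ω k → Submodule ℝ (EuclideanSpace ℝ (Fin (r k)))),
      0 < δ → (∀ k, (δ : EReal) ≤ minEigenGap (SY k) d) →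
      (∀ k, IsTopEigenvectors (SY k) (v k)) →
      (∀ k, envelope (SY k) (SXY k)ᵀ ≤ Submodule.span ℝ (Set.range (v k))) →
      (∀ k, u k = Module.finrank ℝ (envelope (SY k) (SXY k)ᵀ)) → (∀ k, 1 ≤ u k) →
      ((fun k => max
          (p k * r k * √(Real.log (p k) + Real.log (r k)))
          (p k * r k * (scoreGap ((SXY k)ᵀ * SXY k) (v k) (u k))⁻¹ *
            √(Real.log (p k) + Real.log (r k))))
        =o[atTop] fun k => √(n k : ℝ)) →
      (∀ k ω, IsNIECEOutput (SYhat k ω) ((SXYhat k ω)ᵀ * SXYhat k ω) d (u k) (Ehat k ω)) →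
      TendstoZeroInProbability μ fun k ω =>
        frobNorm (projMatrix (Ehat k ω) - projMatrix (envelope (SY k) (SXY k)ᵀ))) ∧
    -- predictor envelope: `M = Σ_X`, `U = Σ_XY Σ_YX`
    (∀ (d : ℕ) (δ : ℝ) (u : ℕ → ℕ) (v : ∀ k, Fin d → EuclideanSpace ℝ (Fin (p k)))
        (Ehat : ∀ k, Ω k → Submodule ℝ (EuclideanSpace ℝ (Fin (p k)))),
      0 < δ → (∀ k, (δ : EReal) ≤ minEigenGap (SX k) d) →
      (∀ k, IsTopEigenvectors (SX k) (v k)) →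
      (∀ k, envelope (SX k) (SXY k) ≤ Submodule.span ℝ (Set.range (v k))) →
      (∀ k, u k = Module.finrank ℝ (envelope (SX k) (SXY k))) → (∀ k, 1 ≤ u k) →
      ((fun k => max
          (p k * r k * √(Real.log (p k) + Real.log (r k)))
          (p k * r k * (scoreGap (SXY k * (SXY k)ᵀ) (v k) (u k))⁻¹ *
            √(Real.log (p k) + Real.log (r k))))
        =o[atTop] fun k => √(n k : ℝ)) →
      (∀ k ω, IsNIECEOutput (SXhat k ω) (SXYhat k ω * (SXYhat k ω)ᵀ) d (u k) (Ehat k ω)) →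
      TendstoZeroInProbability μ fun k ω =>
        frobNorm (projMatrix (Ehat k ω) - projMatrix (envelope (SX k) (SXY k)))) := by
  have hK : 0 ≤ c₁ := by
    have := hc₁ 0
    linarith [l1Norm_nonneg (SXY 0), l1Norm_nonneg (SXY 0)ᵀ]
  have hn0 := hn.eventually_gt_atTop 0
  have hp0 := hp.eventually_gt_atTop 0
  have hr0 := hr.eventually_gt_atTop 0
  -- Measurability of `X k` comes from its identical distribution with an observation, so at least
  -- one observation is required.
  have hXC : ∀ k, 0 < n k → ∀ i, Integrable (fun ω => X k ω i ^ 4) (μ k) ∧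
      ∫ ω, X k ω i ^ 4 ∂(μ k) ≤ fourthMomentBound σ := fun k hk i =>
    integrable_pow_four_of_tail
      (((measurable_pi_apply i).comp measurable_fst).comp_aemeasurable
        (hident k ⟨0, hk⟩).aemeasurable_snd) hσ fun _ ht => (hsub k).tail_left i ht
  have hYC : ∀ k, 0 < n k → ∀ j, Integrable (fun ω => Y k ω j ^ 4) (μ k) ∧
      ∫ ω, Y k ω j ^ 4 ∂(μ k) ≤ fourthMomentBound σ := fun k hk j =>
    integrable_pow_four_of_tail
      (((measurable_pi_apply j).comp measurable_snd).comp_aemeasurable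
        (hident k ⟨0, hk⟩).aemeasurable_snd) hσ fun _ ht => (hsub k).tail_right j ht
  have hSYX : ∀ k, (SXY k)ᵀ = crossCov (μ k) (Y k) (X k) := fun k => by
    rw [hSXY, crossCov_transpose]
  constructor
  · intro d δ u v Ehat hδ hgap hv hE hu hu1 hrate hout
    have hMh : ∀ k, (SY k).IsHermitian := fun k => by
      rw [Matrix.IsHermitian, Matrix.conjTranspose_eq_transpose_of_trivial, hSY,
        crossCov_transpose]
    obtain ⟨h1, h2⟩ := tendsto_rates_of_isLittleO hp hr
      (fun k => scoreGap_pos (hMh k) hδ (hgap k) (hv k) (SXY k) (hE k) (hu k) (hu1 k)) hrate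
    -- Response case: `A = Σ_XY`, with `Y` in the role of the vector whose covariance is `M`.
    refine tendstoZeroInProbability_niece (q := p) hn0 hr0 hp0 hiid hident
      (g := fun k => Prod.snd) (h := fun k => Prod.fst)
      (fun k => measurable_snd) (fun k => measurable_fst) (fourthMomentBound_nonneg σ) hYC hXC
      hSY hSXY hK (fun k => norm_toEuclideanLin_le_of_l1Norm_le hK ?_ ?_) hδ hgap hv hE hu hu1
      ?_ ?_ fun k ω => ?_
    · linarith [hc₁ k, l1Norm_nonneg (SXY k)ᵀ]
    · linarith [hc₁ k, l1Norm_nonneg (SXY k)]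
    · simpa only [mul_comm (p _ : ℝ)] using h1
    · simpa only [mul_comm (p _ : ℝ)] using h2
    · simpa only [hSYhat, hSXYhat] using hout k ω
  · intro d δ u v Ehat hδ hgap hv hE hu hu1 hrate hout
    have hMh : ∀ k, (SX k).IsHermitian := fun k => by
      rw [Matrix.IsHermitian, Matrix.conjTranspose_eq_transpose_of_trivial, hSX,
        crossCov_transpose]
    obtain ⟨h1, h2⟩ := tendsto_rates_of_isLittleO hp hr
      (fun k => scoreGap_pos (hMh k) hδ (hgap k) (hv k) (SXY k)ᵀ (hE k) (hu k) (hu1 k)) hrate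
    -- Predictor case: the roles of `X` and `Y` are exchanged and `A = Σ_YX`, so that `Aᵀ` is `Σ_XY`
    -- by definition.
    refine tendstoZeroInProbability_niece (q := r) (A := fun k => (SXY k)ᵀ) hn0 hp0 hr0 hiid hident
      (g := fun k => Prod.fst) (h := fun k => Prod.snd)
      (fun k => measurable_fst) (fun k => measurable_snd) (fourthMomentBound_nonneg σ) hXC hYC
      hSX hSYX hK (fun k => norm_toEuclideanLin_le_of_l1Norm_le hK ?_ ?_) hδ hgap hv hE hu hu1
      h1 h2 fun k ω => ?_
    · linarith [hc₁ k, l1Norm_nonneg (SXY k)]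
    · rw [Matrix.transpose_transpose]
      linarith [hc₁ k, l1Norm_nonneg (SXY k)ᵀ]
    · have := hout k ω
      rw [hSXhat, hSXYhat] at this
      rw [sampleCrossCov_transpose, ← sampleCrossCov_transpose _ fun s => (Ys k s ω)]
      exact this
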